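/- **Setting.** Let $\mathcal S$ be a set of positive integers. For each $W\in\mathcal S$ let $\mathcal A_W$ be a $\star$-algebra over $\mathbb R$ of complex $W\times W$ matrices (a real vector space of matrices closed under products and adjoints, not assumed to contain $I$). Put $\mathcal T_W=\{T: T^\dagger\mathcal A_WT\subset\mathcal A_W\}$, $\mathcal A_W^H=\{V\in\mathcal A_W: V=V^\dagger\}$, $D_W=\dim_{\mathbb R}\mathcal A_W^H$, and let $\mathcal{AT}_W$ be the real $\star$-algebra generated by $\mathcal A_W\cup\mathcal T_W$. $\|\cdot\|$ is the operator norm, and $\|M^{-1}\|=\infty$ if $M$ is singular. **Diagonal blocks.** $(\mathbb P_W)_{W\in\mathcal S}$ are probability measures on $\mathcal A_W^H$ with densities $\rho_W$ with respect to Lebesgue measure on $\mathcal A_W^H$, and there are $\kappa>0$, $\sigma\ge0$, $p_0,\delta,\epsilon>0$ and $L,a,\zeta\ge0$ such that for every $W\in\mathcal S$: * for all $A,B\in\mathcal A_W^H$, $C\in\mathcal{AT}_W$ and $t>0$, $$\mathbb P_W\{V:\|(V-A)^{-1}\|>tW^{1+\sigma}\}\le\frac{\kappa}{t},\qquad \mathbb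 P_W\otimes\mathbb P_W\Big\{(V_1,V_2):\Big\|\begin{pmatrix}V_1-A&C\\C^\dagger&V_2-B\end{pmatrix}^{-1}\Big\|>tW^{1+\sigma}\Big\}\le\frac{2\kappa}{t};$$ * there is a measurable $\Omega_W\subset\mathcal A_W^H$ with $\mathbb P_W(\Omega_W)\ge p_0$ such that for every $V\in\Omega_W$ one has $\|V\|\le LW^a$, and $\rho_W(V_1)\ge\delta\,\rho_W(V_2)$ for all $V_1,V_2\in\mathcal A_W^H$ with $\|V_1-V\|,\|V_2-V\|\le\epsilon W^{-\zeta}$. **Off-diagonal blocks.** $(\mathbb Q_W)_{W\in\mathcal S}$ are probability measures on the $W\times W$ matrices, supported on $\mathcal T_W$, and there are $q_0,\tau>0$, $b\ge0$ with $\mathbb Q_W\{T:\|T\|\le\tau W^b\}\ge q_0$ for all $W\in\mathcal S$. **Band matrix.** For $W\in\mathcal S$ let $V_1,V_2,\dots$ and $T_1,T_2,\dots$ be random $W\times W$ matrices, all mutually independent, each $V_j$ with distribution $\mathbb P_W$ and each $T_j$ with distribution $\mathbb Q_W$. Let $X_{W;nW}$ be the hermitian block tridiagonal $nW\times nW$ matrix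 with diagonal blocks $V_1,\dots,V_n$, with $T_j$ in block position $(j,j+1)$ and $T_j^\dagger$ in block position $(j+1,j)$, $1\le j\le n-1$. Let $P_j$ be the projection onto the $j$-th block; $P_iMP_j$ is regarded as a $W\times W$ matrix. **Lemma F for $X_{W;nW}$.** Let $\nu>0$ satisfy $\sup_{W\in\mathcal S}D_WW^{-\nu}<\infty$ and $\nu\ge\zeta+\max(a,1+\sigma+2b)$. Then for all $0<r<s<1$ and $0<\Lambda<\infty$ there is $C_{r,s}>0$ (which may depend on $\Lambda$ and on the given families, but not on $W,n,i,j,\lambda,\Phi$) such that for all $W\in\mathcal S$, all $n$, all $1\le i,j\le n$ with $|i-j|\ge3$, all $\lambda\in[-\Lambda,\Lambda]$, and every measurable $\Phi:\mathcal{AT}_W\to\mathbb R$ with $\Phi(Y)\ge0$ and $\Phi(\alpha Y)=\alpha\Phi(Y)$ for $\alpha\ge0$, $$\mathbb E\big[\Phi(P_i(X_{W;nW}-\lambda I)^{-1}P_j)^r\big]\le e^{-C_{r,s}W^{-2\nu}|i-j|}\;\mathbb E\big[\Phi(P_i(X_{W;nW}-\lambda I)^{-1}P_j)^s\big]^{r/s},$$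 where the expectations take values in $[0,\infty]$. -/

import Mathlib

open MeasureTheory ProbabilityTheory
open scoped ENNReal Matrix

namespace BandMatrix

/-- Complex matrices carry the (entrywise) Borel sigma-algebra. -/
noncomputable instance instMeasurableSpaceMatrix {m n : Type*} : MeasurableSpace (Matrix m n ℂ) :=
  inferInstanceAs (MeasurableSpace (m → n → ℂ))

instance instBorelSpaceMatrix {m n : Type*} [Finite m] [Finite n] :
    BorelSpace (Matrix m n ℂ) :=
  inferInstanceAs (BorelSpace (m → n → ℂ))

/-- The complex `W × W` matrices. -/
abbrev Mat (W : ℕ) : Type := Matrix (Fin W) (Fin W) ℂ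

/-- The operator norm of a square matrix, with respect to the Euclidean norm on vectors. -/
noncomputable def opNorm {ι : Type*} [Fintype ι] [DecidableEq ι] (M : Matrix ι ι ℂ) : ℝ :=
  ‖Matrix.toEuclideanCLM (𝕜 := ℂ) M‖

open Classical in
/-- The operator norm of `M⁻¹`, equal to `∞` when `M` is singular. -/
noncomputable def invNorm {ι : Type*} [Fintype ι] [DecidableEq ι] (M : Matrix ι ι ℂ) : ℝ≥0∞ :=
  if IsUnit M then ENNReal.ofReal (opNorm M⁻¹) else ∞

section Algebra

variable {W : ℕ}

/-- `𝒯_W`: the matrices `T` such that `T† 𝒜 T ⊆ 𝒜`. A not necessarily unital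
`NonUnitalStarSubalgebra ℝ` is a real vector space of matrices closed under products and
adjoints. -/
def conjSet (A : NonUnitalStarSubalgebra ℝ (Mat W)) : Set (Mat W) :=
  {T | ∀ V ∈ A, Tᴴ * V * T ∈ A}

/-- The real star algebra generated by `𝒜_W` and `𝒯_W`. -/
noncomputable def genAlg (A : NonUnitalStarSubalgebra ℝ (Mat W)) :
    NonUnitalStarSubalgebra ℝ (Mat W) :=
  NonUnitalStarAlgebra.adjoin ℝ ((A : Set (Mat W)) ∪ conjSet A)

/-- `𝒜_W^H`: the real vector space of hermitian elements of `𝒜_W`. -/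
def herm (A : NonUnitalStarSubalgebra ℝ (Mat W)) : Submodule ℝ (Mat W) where
  carrier := {V | V ∈ A ∧ V.IsHermitian}
  zero_mem' := ⟨zero_mem A, Matrix.isHermitian_zero⟩
  add_mem' := fun h₁ h₂ => ⟨add_mem h₁.1 h₂.1, h₁.2.add h₂.2⟩
  smul_mem' := fun c V h => by
    refine ⟨SMulMemClass.smul_mem c h.1, ?_⟩
    have h2 : Vᴴ = V := h.2
    simp [Matrix.IsHermitian, Matrix.conjTranspose_smul, h2]

/-- `D_W`: the real dimension of `𝒜_W^H`. -/
noncomputable def hermDim (A : NonUnitalStarSubalgebra ℝ (Mat W)) : ℕ :=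
  Module.finrank ℝ (herm A)

/-- Lebesgue measure on `𝒜_W^H`, viewed as a measure on all `W × W` matrices: the image of
Lebesgue measure on `ℝ^{D_W}` under linear coordinates. Another choice of the basis multiplies
this measure by a positive constant. -/
noncomputable def hermVolume (A : NonUnitalStarSubalgebra ℝ (Mat W)) : Measure (Mat W) :=
  (volume : Measure (Fin (Module.finrank ℝ (herm A)) → ℝ)).map
    (fun x => ∑ k, x k • ((Module.finBasis ℝ (herm A) k : herm A) : Mat W))

end Algebra

/-- The assumptions on the distributions `P W` (with densities `ρ W`) of the diagonal blocks:
absolute continuity on `𝒜_W^H`, the two Wegner-type estimates, and fluctuation regularity with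
bounded tails. -/
structure DiagonalAssumption (S : Set ℕ)
    (A : ∀ W : ℕ, NonUnitalStarSubalgebra ℝ (Mat W))
    (P : ∀ W : ℕ, Measure (Mat W)) (ρ : ∀ W : ℕ, Mat W → ℝ)
    (κ σ p₀ δ ε L a ζ : ℝ) : Prop where
  isProbabilityMeasure : ∀ W ∈ S, IsProbabilityMeasure (P W)
  measurable_density : ∀ W ∈ S, Measurable (ρ W)
  density_nonneg : ∀ W ∈ S, ∀ V, 0 ≤ ρ W V
  absolutelyContinuous : ∀ W ∈ S,
    P W = (hermVolume (A W)).withDensity (fun V => ENNReal.ofReal (ρ W V))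
  kappa_pos : 0 < κ
  sigma_nonneg : 0 ≤ σ
  wegner_one : ∀ W ∈ S, ∀ B ∈ herm (A W), ∀ t : ℝ, 0 < t →
    P W {V | ENNReal.ofReal (t * (W : ℝ) ^ (1 + σ)) < invNorm (V - B)}
      ≤ ENNReal.ofReal (κ * (1 / t))
  wegner_two : ∀ W ∈ S, ∀ B₁ ∈ herm (A W), ∀ B₂ ∈ herm (A W), ∀ C ∈ genAlg (A W),
    ∀ t : ℝ, 0 < t →
    ((P W).prod (P W)) {V | ENNReal.ofReal (t * (W : ℝ) ^ (1 + σ)) <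
        invNorm (Matrix.fromBlocks (V.1 - B₁) C Cᴴ (V.2 - B₂))}
      ≤ ENNReal.ofReal (2 * κ * (1 / t))
  p₀_pos : 0 < p₀
  delta_pos : 0 < δ
  epsilon_pos : 0 < ε
  L_nonneg : 0 ≤ L
  a_nonneg : 0 ≤ a
  zeta_nonneg : 0 ≤ ζ
  /-- The bound `ρ(V₁) / ρ(V₂) ≥ δ` is written without division. -/
  fluctuation_regular : ∀ W ∈ S, ∃ E : Set (Mat W), MeasurableSet E ∧
    E ⊆ (herm (A W) : Set (Mat W)) ∧ ENNReal.ofReal p₀ ≤ P W E ∧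
    ∀ V ∈ E, opNorm V ≤ L * (W : ℝ) ^ a ∧
      ∀ V₁ ∈ herm (A W), ∀ V₂ ∈ herm (A W),
        opNorm (V₁ - V) ≤ ε * (W : ℝ) ^ (-ζ) → opNorm (V₂ - V) ≤ ε * (W : ℝ) ^ (-ζ) →
          δ * ρ W V₂ ≤ ρ W V₁

/-- The assumptions on the distributions `Q W` of the off-diagonal blocks: support in `𝒯_W` and
a uniform bound on the tails. -/
structure OffDiagonalAssumption (S : Set ℕ)
    (A : ∀ W : ℕ, NonUnitalStarSubalgebra ℝ (Mat W))
    (Q : ∀ W : ℕ, Measure (Mat W)) (q₀ τ b : ℝ) : Prop where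
  isProbabilityMeasure : ∀ W ∈ S, IsProbabilityMeasure (Q W)
  supported : ∀ W ∈ S, ∀ᵐ T ∂(Q W), T ∈ conjSet (A W)
  q₀_pos : 0 < q₀
  tau_pos : 0 < τ
  b_nonneg : 0 ≤ b
  norm_bound : ∀ W ∈ S, ENNReal.ofReal q₀ ≤ Q W {T | opNorm T ≤ τ * (W : ℝ) ^ b}

section Band

variable {W : ℕ}

/-- The `nW × nW` hermitian block tridiagonal matrix `X_{W;nW}` with diagonal blocks `V k` and
blocks `T k` in position `(k, k+1)`, `(T k)†` in position `(k+1, k)`. Blocks are numbered from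
`0`, and the row `(i, x)` is row `x` of block `i`. -/
def bandMatrix (n : ℕ) (V T : ℕ → Mat W) : Matrix (Fin n × Fin W) (Fin n × Fin W) ℂ :=
  Matrix.of fun p q =>
    if p.1 = q.1 then V p.1 p.2 q.2
    else if (q.1 : ℕ) = p.1 + 1 then T p.1 p.2 q.2
    else if (p.1 : ℕ) = q.1 + 1 then (T q.1)ᴴ p.2 q.2
    else 0

/-- The `W × W` block `P_i (X_{W;nW} - λ I)⁻¹ P_j` of the resolvent. -/
noncomputable def resolventBlock (n : ℕ) (V T : ℕ → Mat W) (lam : ℝ) (i j : Fin n) : Mat W :=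
  ((bandMatrix n V T - (lam : ℂ) • (1 : Matrix (Fin n × Fin W) (Fin n × Fin W) ℂ))⁻¹).submatrix
    (fun x => (i, x)) (fun y => (j, y))

end Band

end BandMatrix

namespace BandMatrix

/-! ### Linear algebra -/

section InverseClosed

variable {ι : Type*} [Fintype ι] [DecidableEq ι]

/-! Eliminating the first block by a Schur complement leaves a shorter band matrix of the same kind,
in which only the new first diagonal block has changed: it loses the self-energy T†(V - B - λ)⁻¹T,
where B is the energy that the eliminated site itself received. So a block of the resolvent above
the diagonal factors along the chain into one hop -(V - B - λ)⁻¹T per eliminated site from the row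
index on, times a block of the remaining chain, which sees the past only through the energy handed
to it (`chainBlock_zero_succ`). Blocks below the diagonal are adjoints of these.

The r-th and s-th moments could be nearly equal in Jensen's sense only if the observable were nearly
constant. It is not. Among three consecutive sites, multiply the pivot V - B - λ of the middle one
by c > 1. Its hop and its outgoing energy are both multiplied by c⁻¹. Translating the diagonal block
of the last site absorbs the change of energy, so the last hop and everything after it stay the
same. The product of the three hops is thus scaled by c⁻¹ with nothing else moved
(`threeSites_scaleMiddle`).

This change of variables is affine in each block and moves the block by at most (c - 1)(‖V‖ +
‖energy‖ + |λ|). The first site serves to bound, with positive probability, the energy that enters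
the middle one. If c - 1 is of order W^(-ν), the displacement stays inside the ball on which the
density is regular, so the map distorts probability only by a bounded factor, the Jacobian being
harmless because c ≥ 1 (`RegularSite.scaleMiddle_bound`). A quantitative Jensen inequality
(`lintegral_rpow_le_of_scaling`) turns this into a factor 1 - const (c - 1)² for each triple,
uniformly in the incoming energy.

Conditioning on the sites in order and iterating over disjoint triples multiplies the gains
(`RegularSite.chain_decay_zero`); sites before the row index cost nothing by Jensen
(`RegularSite.chain_decay`). -/

theorem one_mem_of_mul_mem (M : Submodule ℝ (Matrix ι ι ℂ)) (hM : ∀ a ∈ M, ∀ b ∈ M, a * b ∈ M)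
    {X : Matrix ι ι ℂ} (hX : X ∈ M) (hu : IsUnit X) : (1 : Matrix ι ι ℂ) ∈ M := by
  -- Multiplication by an invertible X is injective on the finite-dimensional space M, hence onto M;
  -- the preimage of X itself can only be the identity.
  let f : M →ₗ[ℝ] M := (LinearMap.mulLeft ℝ X).restrict (fun b hb => hM X hX b hb)
  have hinj : Function.Injective f := by
    intro a b hab
    have : X * (a : Matrix ι ι ℂ) = X * b := congrArg Subtype.val hab
    exact Subtype.ext (hu.mul_left_cancel this)
  obtain ⟨N, hN⟩ := LinearMap.injective_iff_surjective.1 hinj ⟨X, hX⟩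
  have h1 : X * (N : Matrix ι ι ℂ) = X := congrArg Subtype.val hN
  have h2 : (N : Matrix ι ι ℂ) = 1 := hu.mul_left_cancel (h1.trans (mul_one X).symm)
  exact h2 ▸ N.2

/-- A space of matrices that is closed under products is closed under inverses. -/
theorem inv_mem_of_mul_mem (M : Submodule ℝ (Matrix ι ι ℂ)) (hM : ∀ a ∈ M, ∀ b ∈ M, a * b ∈ M)
    {X : Matrix ι ι ℂ} (hX : X ∈ M) : X⁻¹ ∈ M := by
  by_cases hu : IsUnit X
  · let f : M →ₗ[ℝ] M := (LinearMap.mulLeft ℝ X).restrict (fun b hb => hM X hX b hb)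
    have hinj : Function.Injective f := by
      intro a b hab
      have : X * (a : Matrix ι ι ℂ) = X * b := congrArg Subtype.val hab
      exact Subtype.ext (hu.mul_left_cancel this)
    obtain ⟨N, hN⟩ := LinearMap.injective_iff_surjective.1 hinj ⟨1, one_mem_of_mul_mem M hM hX hu⟩
    have h1 : X * (N : Matrix ι ι ℂ) = 1 := congrArg Subtype.val hN
    rw [Matrix.inv_eq_right_inv h1]
    exact N.2
  · rw [Matrix.nonsing_inv_eq_ringInverse, Ring.inverse_non_unit _ hu]
    exact M.zero_mem

/-- Nonsingular inverses commute with nonzero scalars, also for singular matrices. -/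
theorem smul_inv_of_ne_zero {c : ℝ} (hc : c ≠ 0) (X : Matrix ι ι ℂ) :
    (c • X)⁻¹ = c⁻¹ • X⁻¹ := by
  by_cases hu : IsUnit X.det
  · refine Matrix.inv_eq_right_inv ?_
    rw [smul_mul_smul_comm, mul_inv_cancel₀ hc, one_smul, Matrix.mul_nonsing_inv _ hu]
  · have h2 : ¬ IsUnit (c • X).det := by
      have : c • X = (c : ℂ) • X := by ext; simp
      rw [this, Matrix.det_smul]
      simp only [isUnit_iff_ne_zero, ne_eq, not_not] at hu ⊢
      simp [hu]
    rw [Matrix.nonsing_inv_apply_not_isUnit _ hu, Matrix.nonsing_inv_apply_not_isUnit _ h2,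
      smul_zero]

end InverseClosed

/-! ### Membership and symmetry of self-energies and resolvent blocks -/

section Herm

variable {W : ℕ} {A : NonUnitalStarSubalgebra ℝ (Mat W)}

theorem inv_mem_herm {X : Mat W} (hX : X ∈ herm A) : X⁻¹ ∈ herm A := by
  refine ⟨inv_mem_of_mul_mem A.toNonUnitalSubalgebra.toSubmodule
    (fun a ha b hb => mul_mem (S := NonUnitalStarSubalgebra ℝ (Mat W)) (s := A) ha hb) hX.1, ?_⟩
  exact Matrix.IsHermitian.inv hX.2

/-- The algebra need not be unital a priori, but one invertible element forces the identity into it.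
This makes shifts by the spectral parameter admissible. -/
theorem smul_one_mem_herm {X : Mat W} (hX : X ∈ herm A) (hu : IsUnit X) (c : ℝ) :
    (c : ℂ) • (1 : Mat W) ∈ herm A := by
  have h1 : (1 : Mat W) ∈ herm A :=
    ⟨one_mem_of_mul_mem A.toNonUnitalSubalgebra.toSubmodule
      (fun a ha b hb => mul_mem (S := NonUnitalStarSubalgebra ℝ (Mat W)) (s := A) ha hb) hX.1 hu,
      Matrix.isHermitian_one⟩
  have := (herm A).smul_mem c h1
  rwa [show c • (1 : Mat W) = (c : ℂ) • (1 : Mat W) by ext; simp] at this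

theorem conj_mem_herm {T X : Mat W} (hT : T ∈ conjSet A) (hX : X ∈ herm A) :
    Tᴴ * X * T ∈ herm A :=
  ⟨hT X hX.1, Matrix.isHermitian_conjTranspose_mul_mul T hX.2⟩

theorem herm_subset_genAlg {X : Mat W} (hX : X ∈ herm A) : X ∈ genAlg A :=
  NonUnitalStarAlgebra.subset_adjoin ℝ _ (Or.inl hX.1)

theorem conjSet_subset_genAlg {T : Mat W} (hT : T ∈ conjSet A) : T ∈ genAlg A :=
  NonUnitalStarAlgebra.subset_adjoin ℝ _ (Or.inr hT)

/-- The matrices whose `W × W` blocks lie in the generated algebra. -/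
def blockGenAlg (A : NonUnitalStarSubalgebra ℝ (Mat W)) (n : ℕ) :
    Submodule ℝ (Matrix (Fin n × Fin W) (Fin n × Fin W) ℂ) where
  carrier := {X | ∀ i j : Fin n,
    X.submatrix (fun x : Fin W => (i, x)) (fun y : Fin W => (j, y)) ∈ genAlg A}
  zero_mem' := fun _ _ => zero_mem (genAlg A)
  add_mem' := fun h₁ h₂ i j => add_mem (h₁ i j) (h₂ i j)
  smul_mem' := fun c _ h i j => SMulMemClass.smul_mem c (h i j)

theorem blockGenAlg_mul {n : ℕ} : ∀ X ∈ blockGenAlg A n, ∀ Y ∈ blockGenAlg A n,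
    X * Y ∈ blockGenAlg A n := by
  intro X hX Y hY i j
  have : (X * Y).submatrix (fun x : Fin W => (i, x)) (fun y : Fin W => (j, y)) =
      ∑ k, X.submatrix (fun x : Fin W => (i, x)) (fun y : Fin W => (k, y)) *
        Y.submatrix (fun x : Fin W => (k, x)) (fun y : Fin W => (j, y)) := by
    ext x y
    simp [Matrix.mul_apply, Matrix.sum_apply, Fintype.sum_prod_type]
  rw [this]
  exact sum_mem fun k _ => mul_mem (hX i k) (hY k j)

/-- Matrices with all blocks in the generated algebra form a space closed under products, hence
under inverses; it contains the band matrix and λ times the identity. -/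
theorem resolventBlock_mem_genAlg {n : ℕ} {V T : ℕ → Mat W} {lam : ℝ}
    (hlam : (lam : ℂ) • (1 : Mat W) ∈ herm A) (hV : ∀ k, V k ∈ herm A) (hT : ∀ k, T k ∈ conjSet A)
    (i j : Fin n) : resolventBlock n V T lam i j ∈ genAlg A := by
  refine inv_mem_of_mul_mem (blockGenAlg A n) blockGenAlg_mul (X := _ - _) ?_ i j
  intro i j
  by_cases hij : i = j
  · subst hij
    convert! herm_subset_genAlg ((herm A).sub_mem (hV i) hlam) using 1
    ext x y
    simp [bandMatrix, Matrix.one_apply]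
  · by_cases h1 : (j : ℕ) = i + 1
    · convert! conjSet_subset_genAlg (hT i) using 1
      ext x y
      simp [bandMatrix, hij, h1]
    · by_cases h2 : (i : ℕ) = j + 1
      · convert! star_mem (conjSet_subset_genAlg (hT j)) using 1
        ext x y
        have h3 : ¬ (j : ℕ) = j + 1 + 1 := by omega
        simp [bandMatrix, hij, h2, h3]
      · convert! zero_mem (genAlg A) using 1
        ext x y
        simp [bandMatrix, hij, h1, h2]

theorem resolventBlock_conjTranspose {n : ℕ} {V T : ℕ → Mat W} (lam : ℝ)
    (hV : ∀ k, (V k).IsHermitian) (i j : Fin n) :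
    (resolventBlock n V T lam i j)ᴴ = resolventBlock n V T lam j i := by
  have hX : (bandMatrix n V T).IsHermitian := by
    ext p q
    simp only [Matrix.conjTranspose_apply, bandMatrix, Matrix.of_apply]
    by_cases hij : p.1 = q.1
    · rw [if_pos hij.symm, if_pos hij, ← hij]
      exact (hV _).apply _ _
    · rw [if_neg (Ne.symm hij), if_neg hij]
      by_cases h1 : (q.1 : ℕ) = p.1 + 1
      · have h2 : ¬ (p.1 : ℕ) = q.1 + 1 := by omega
        rw [if_neg h2, if_pos h1, if_pos h1]
        exact star_star _
      · by_cases h2 : (p.1 : ℕ) = q.1 + 1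
        · rw [if_pos h2, if_neg h1, if_pos h2]
        · simp [h1, h2]
  have hX' : (bandMatrix n V T -
      (lam : ℂ) • (1 : Matrix (Fin n × Fin W) (Fin n × Fin W) ℂ)).IsHermitian := by
    refine hX.sub ?_
    simp [Matrix.IsHermitian, Matrix.conjTranspose_smul]
  unfold resolventBlock
  rw [Matrix.conjTranspose_submatrix, hX'.inv.eq]

end Herm

/-! ### Schur complement with respect to the first block -/

section Schur

variable {W : ℕ}

/-- Subtract `B` from the first matrix of a sequence. -/
def subHead (B : Mat W) (V : ℕ → Mat W) : ℕ → Mat W :=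
  fun k => if k = 0 then V 0 - B else V k

/-- Separation of the first block. -/
def headEquiv (n W : ℕ) : Fin W ⊕ (Fin n × Fin W) ≃ Fin (n + 1) × Fin W where
  toFun := Sum.elim (fun x => (0, x)) (fun p => (p.1.succ, p.2))
  invFun p := Fin.cases (motive := fun _ => Fin W ⊕ (Fin n × Fin W)) (Sum.inl p.2)
    (fun i => Sum.inr (i, p.2)) p.1
  left_inv := by rintro (x | ⟨i, x⟩) <;> rfl
  right_inv := by
    rintro ⟨i, x⟩
    refine Fin.cases ?_ (fun i => ?_) i <;> rfl

variable (n : ℕ) (V T : ℕ → Mat W) (lam : ℝ)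

/-- The first block row without its first block. -/
def headRow : Matrix (Fin W) (Fin n × Fin W) ℂ :=
  Matrix.of fun x p => if (p.1 : ℕ) = 0 then T 0 x p.2 else 0

theorem submatrix_headEquiv :
    (bandMatrix (n + 1) V T - (lam : ℂ) • (1 : Matrix (Fin (n + 1) × Fin W) _ ℂ)).submatrix
      (headEquiv n W) (headEquiv n W) =
    Matrix.fromBlocks (V 0 - (lam : ℂ) • 1) (headRow n T) (headRow n T)ᴴ
      (bandMatrix n (fun k => V (k + 1)) (fun k => T (k + 1)) - (lam : ℂ) • 1) := by
  ext (x | ⟨i, x⟩) (y | ⟨j, y⟩)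
  · simp [headEquiv, bandMatrix, Matrix.one_apply]
  · simp [headEquiv, bandMatrix, headRow, (Fin.succ_ne_zero _).symm]
  · simp [headEquiv, bandMatrix, headRow, Fin.succ_ne_zero]
    split_ifs <;> simp
  · simp [headEquiv, bandMatrix, Matrix.one_apply]


variable {n V T lam}

/-- The first block row meets only the neighbouring block, so the Schur correction sits in a single
diagonal block and the band structure survives. -/
theorem schur_head (X : Mat W) :
    (bandMatrix n (fun k => V (k + 1)) (fun k => T (k + 1)) - (lam : ℂ) • 1) -
      (headRow n T)ᴴ * X * headRow n T =
    bandMatrix n (subHead ((T 0)ᴴ * X * T 0) (fun k => V (k + 1))) (fun k => T (k + 1)) -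
      (lam : ℂ) • 1 := by
  have key : (headRow n T)ᴴ * X * headRow n T = Matrix.of fun (p q : Fin n × Fin W) =>
      if (p.1 : ℕ) = 0 ∧ (q.1 : ℕ) = 0 then ((T 0)ᴴ * X * T 0) p.2 q.2 else 0 := by
    ext ⟨i, x⟩ ⟨j, y⟩
    simp only [Matrix.mul_apply, headRow, Matrix.conjTranspose_apply, Matrix.of_apply]
    by_cases h1 : (i : ℕ) = 0 <;> by_cases h2 : (j : ℕ) = 0 <;> simp [h1, h2]
  rw [key]
  ext ⟨i, x⟩ ⟨j, y⟩
  simp only [Matrix.sub_apply, bandMatrix, Matrix.of_apply, subHead]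
  by_cases hij : i = j
  · subst hij
    by_cases h1 : (i : ℕ) = 0
    · simp [h1]; ring
    · simp [h1]
  · have : ¬ ((i : ℕ) = 0 ∧ (j : ℕ) = 0) := fun h => hij (Fin.ext (h.1.trans h.2.symm))
    simp [hij, this]

theorem inv_head_blocks (hu : IsUnit (V 0 - (lam : ℂ) • (1 : Mat W))) :
    ∃ P Q, (bandMatrix (n + 1) V T - (lam : ℂ) • (1 : Matrix (Fin (n + 1) × Fin W) _ ℂ))⁻¹.submatrix
      (headEquiv n W) (headEquiv n W) =
    Matrix.fromBlocks P (-((V 0 - (lam : ℂ) • (1 : Mat W))⁻¹ * headRow n T *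
      (bandMatrix n (subHead ((T 0)ᴴ * (V 0 - (lam : ℂ) • (1 : Mat W))⁻¹ * T 0)
        (fun k => V (k + 1))) (fun k => T (k + 1)) - (lam : ℂ) • 1)⁻¹)) Q
      (bandMatrix n (subHead ((T 0)ᴴ * (V 0 - (lam : ℂ) • (1 : Mat W))⁻¹ * T 0)
        (fun k => V (k + 1))) (fun k => T (k + 1)) - (lam : ℂ) • 1)⁻¹ := by
  rw [← Matrix.inv_submatrix_equiv, submatrix_headEquiv, ← schur_head]
  set H := V 0 - (lam : ℂ) • (1 : Mat W)
  set D := bandMatrix n (fun k => V (k + 1)) (fun k => T (k + 1)) - (lam : ℂ) • 1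
  set R := headRow n T
  let := hu.invertible
  have hinv : H⁻¹ = ⅟H := (Matrix.invOf_eq_nonsing_inv H).symm
  rw [hinv]
  by_cases h : IsUnit (D - Rᴴ * ⅟H * R)
  · let := h.invertible
    let := ((Matrix.isUnit_fromBlocks_iff_of_invertible₁₁ (A := H) (B := R) (C := Rᴴ)
      (D := D)).2 h).invertible
    rw [← Matrix.invOf_eq_nonsing_inv, ← Matrix.invOf_eq_nonsing_inv,
      Matrix.invOf_fromBlocks₁₁_eq]
    exact ⟨_, _, rfl⟩
  -- A singular Schur complement makes the whole matrix singular. Both inverses are then 0 by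
  -- convention, so only the pivot has to be invertible.
  · have h' : ¬ IsUnit (Matrix.fromBlocks H R Rᴴ D) := fun h2 =>
      h ((Matrix.isUnit_fromBlocks_iff_of_invertible₁₁).1 h2)
    refine ⟨0, 0, ?_⟩
    rw [Matrix.nonsing_inv_eq_ringInverse, Ring.inverse_non_unit _ h',
      Matrix.nonsing_inv_eq_ringInverse, Ring.inverse_non_unit _ h]
    simp

/-- Elimination of the first block: blocks that avoid it. -/
theorem resolventBlock_succ_succ (hu : IsUnit (V 0 - (lam : ℂ) • (1 : Mat W))) (i j : Fin n) :
    resolventBlock (n + 1) V T lam i.succ j.succ =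
      resolventBlock n (subHead ((T 0)ᴴ * (V 0 - (lam : ℂ) • (1 : Mat W))⁻¹ * T 0)
        (fun k => V (k + 1))) (fun k => T (k + 1)) lam i j := by
  obtain ⟨P, Q, h⟩ := inv_head_blocks (n := n) (T := T) hu
  ext x y
  exact congrFun (congrFun h (Sum.inr (i, x))) (Sum.inr (j, y))

/-- Elimination of the first block: blocks in its row. -/
theorem resolventBlock_zero_succ [NeZero n] (hu : IsUnit (V 0 - (lam : ℂ) • (1 : Mat W)))
    (j : Fin n) :
    resolventBlock (n + 1) V T lam 0 j.succ =
      -((V 0 - (lam : ℂ) • (1 : Mat W))⁻¹ * T 0 *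
      resolventBlock n (subHead ((T 0)ᴴ * (V 0 - (lam : ℂ) • (1 : Mat W))⁻¹ * T 0)
        (fun k => V (k + 1))) (fun k => T (k + 1)) lam 0 j) := by
  obtain ⟨P, Q, h⟩ := inv_head_blocks (n := n) (T := T) hu
  ext x y
  refine (congrFun (congrFun h (Sum.inl x)) (Sum.inr (j, y))).trans ?_
  simp only [Matrix.fromBlocks_apply₁₂, Matrix.neg_apply, Matrix.mul_assoc]
  rw [Matrix.mul_apply, Matrix.mul_apply]
  congr 1
  refine Finset.sum_congr rfl fun z _ => ?_
  congr 1
  rw [Matrix.mul_apply, Matrix.mul_apply, Fintype.sum_prod_type, Finset.sum_eq_single 0]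
  · simp [headRow, resolventBlock]
  · intro k _ hk
    simp [headRow, hk]
  · simp

end Schur

/-! ### A moment inequality with a gain from scaling -/

/-- Square the weighted AM-GM bound z^α ≤ 1 - α + αz; the square of the right side falls short of 1
- α + αz² by exactly α(1 - α)(1 - z)². -/
theorem rpow_add_deficit_le {α z : ℝ} (hα₀ : 0 < α) (hα₁ : α < 1) (hz : 0 ≤ z) :
    (z ^ 2) ^ α + α * (1 - α) * (1 - z) ^ 2 ≤ (1 - α) + α * z ^ 2 := by
  have h1 : z ^ α ≤ 1 - α + α * z := by
    have := Real.geom_mean_le_arith_mean2_weighted (w₁ := 1 - α) (w₂ := α) (p₁ := 1) (p₂ := z)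
      (by linarith) hα₀.le zero_le_one hz (by ring)
    simpa using this
  have h2 : (z ^ 2) ^ α = (z ^ α) ^ 2 := by
    rw [← Real.rpow_natCast, ← Real.rpow_natCast, ← Real.rpow_mul hz, ← Real.rpow_mul hz, mul_comm]
  have h3 : (z ^ α) ^ 2 ≤ (1 - α + α * z) ^ 2 :=
    pow_le_pow_left₀ (Real.rpow_nonneg hz _) h1 2
  rw [h2]
  nlinarith

/-- The numbers z and qz cannot both be close to 1: the minimum over z of the right side is (1 -
q)²/(1 + q²). -/
theorem deficit_pair {q z : ℝ} (hq₀ : 0 ≤ q) (hq₁ : q ≤ 1) :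
    (1 - q) ^ 2 / 2 ≤ (1 - z) ^ 2 + (1 - q * z) ^ 2 := by
  have h : (1 + q ^ 2) * ((1 - z) ^ 2 + (1 - q * z) ^ 2) =
      ((1 + q ^ 2) * z - (1 + q)) ^ 2 + (1 - q) ^ 2 := by ring
  have hq : q ^ 2 ≤ 1 := pow_le_one₀ hq₀ hq₁
  nlinarith [sq_nonneg ((1 + q ^ 2) * z - (1 + q)), sq_nonneg (1 - z), sq_nonneg (1 - q * z)]

variable {X : Type*} [MeasurableSpace X] {μ : Measure X} [IsProbabilityMeasure μ]

/-- The normalised form: `y = z ^ 2` has integral one. -/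
theorem lintegral_rpow_le_of_scaling_normalized {z : X → ℝ} (hz : Measurable z) (hz₀ : ∀ x, 0 ≤ z x)
    (hone : ∫⁻ x, ENNReal.ofReal (z x ^ 2) ∂μ = 1) {S : X → X} {G : Set X} (hG : MeasurableSet G)
    {q K α p : ℝ} (hq₀ : 0 ≤ q) (hq₁ : q ≤ 1) (hK : 0 ≤ K) (hα₀ : 0 < α) (hα₁ : α < 1)
    (hS : ∀ x ∈ G, z (S x) = q * z x)
    (hSK : ∀ g : X → ℝ≥0∞, Measurable g →
      ∫⁻ x in G, g (S x) ∂μ ≤ ENNReal.ofReal K * ∫⁻ x, g x ∂μ)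
    (hp : 0 ≤ p) (hpG : ENNReal.ofReal p ≤ μ G) :
    ∫⁻ x, ENNReal.ofReal ((z x ^ 2) ^ α) ∂μ ≤
      ENNReal.ofReal (1 - α * (1 - α) * ((1 - q) ^ 2 * p / (2 * (1 + K)))) := by
  set I := ∫⁻ x, ENNReal.ofReal ((1 - z x) ^ 2) ∂μ with hI
  have hm : Measurable fun x => ENNReal.ofReal ((1 - z x) ^ 2) := by fun_prop
  have hβ : 0 < α * (1 - α) := mul_pos hα₀ (by linarith)
  -- lower bound of the deficit
  have h1 : ENNReal.ofReal ((1 - q) ^ 2 / 2) * ENNReal.ofReal p ≤ ENNReal.ofReal (1 + K) * I := by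
    calc ENNReal.ofReal ((1 - q) ^ 2 / 2) * ENNReal.ofReal p
        ≤ ENNReal.ofReal ((1 - q) ^ 2 / 2) * μ G := by gcongr
      _ = ∫⁻ x in G, ENNReal.ofReal ((1 - q) ^ 2 / 2) ∂μ := by rw [setLIntegral_const]
      _ ≤ ∫⁻ x in G, (ENNReal.ofReal ((1 - z x) ^ 2) + ENNReal.ofReal ((1 - z (S x)) ^ 2)) ∂μ := by
          refine setLIntegral_mono' hG fun x hx => ?_
          rw [← ENNReal.ofReal_add (sq_nonneg _) (sq_nonneg _), hS x hx]
          exact ENNReal.ofReal_le_ofReal (deficit_pair hq₀ hq₁)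
      _ = ∫⁻ x in G, ENNReal.ofReal ((1 - z x) ^ 2) ∂μ +
            ∫⁻ x in G, ENNReal.ofReal ((1 - z (S x)) ^ 2) ∂μ := lintegral_add_left hm _
      _ ≤ I + ENNReal.ofReal K * I := by
          gcongr
          · exact setLIntegral_le_lintegral _ _
          · exact hSK _ hm
      _ = ENNReal.ofReal (1 + K) * I := by
          rw [ENNReal.ofReal_add zero_le_one hK, ENNReal.ofReal_one, add_mul, one_mul]
  have h2 : ENNReal.ofReal ((1 - q) ^ 2 * p / (2 * (1 + K))) ≤ I := by
    have hK' : 0 < 1 + K := by linarith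
    rw [← ENNReal.ofReal_mul (by positivity)] at h1
    have : ENNReal.ofReal ((1 - q) ^ 2 * p / (2 * (1 + K))) =
        ENNReal.ofReal ((1 - q) ^ 2 / 2 * p) / ENNReal.ofReal (1 + K) := by
      rw [← ENNReal.ofReal_div_of_pos hK']
      congr 1
      field_simp
    rw [this]
    exact ENNReal.div_le_of_le_mul' h1
  -- integrate the pointwise inequality
  have h3 : ∫⁻ x, ENNReal.ofReal ((z x ^ 2) ^ α) ∂μ + ENNReal.ofReal (α * (1 - α)) * I ≤ 1 := by
    calc ∫⁻ x, ENNReal.ofReal ((z x ^ 2) ^ α) ∂μ + ENNReal.ofReal (α * (1 - α)) * I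
        = ∫⁻ x, (ENNReal.ofReal ((z x ^ 2) ^ α) +
            ENNReal.ofReal (α * (1 - α)) * ENNReal.ofReal ((1 - z x) ^ 2)) ∂μ := by
          rw [lintegral_add_left (by fun_prop), lintegral_const_mul _ hm]
      _ ≤ ∫⁻ x, (ENNReal.ofReal (1 - α) + ENNReal.ofReal α * ENNReal.ofReal (z x ^ 2)) ∂μ := by
          refine lintegral_mono fun x => ?_
          rw [← ENNReal.ofReal_mul hβ.le, ← ENNReal.ofReal_mul hα₀.le,
            ← ENNReal.ofReal_add (by positivity) (by positivity),
            ← ENNReal.ofReal_add (by linarith) (by positivity)]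
          exact ENNReal.ofReal_le_ofReal (rpow_add_deficit_le hα₀ hα₁ (hz₀ x))
      _ = 1 := by
          rw [lintegral_add_left measurable_const, lintegral_const_mul _ (by fun_prop), hone,
            lintegral_const, measure_univ, mul_one, mul_one,
            ← ENNReal.ofReal_add (by linarith) hα₀.le]
          simp
  have h4 : ENNReal.ofReal (α * (1 - α) * ((1 - q) ^ 2 * p / (2 * (1 + K)))) ≤
      ENNReal.ofReal (α * (1 - α)) * I := by
    rw [ENNReal.ofReal_mul hβ.le]
    gcongr
  rw [ENNReal.ofReal_sub _ (by positivity), ENNReal.ofReal_one]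
  refine ENNReal.le_sub_of_add_le_right ENNReal.ofReal_ne_top ?_
  exact (add_le_add le_rfl h4).trans h3

theorem lintegral_rpow_le_rpow_lintegral {f : X → ℝ≥0∞} (hf : Measurable f) {r s : ℝ} (hr : 0 < r)
    (hrs : r ≤ s) : ∫⁻ x, f x ^ r ∂μ ≤ (∫⁻ x, f x ^ s ∂μ) ^ (r / s) := by
  have hs : 0 < s := hr.trans_le hrs
  have h := eLpNorm'_le_eLpNorm'_of_exponent_le (μ := μ) hr hrs hf.aestronglyMeasurable
  simp only [eLpNorm'_eq_lintegral_enorm, enorm_eq_self] at h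
  have h2 := ENNReal.rpow_le_rpow h hr.le
  rwa [← ENNReal.rpow_mul, one_div_mul_cancel hr.ne', ENNReal.rpow_one, ← ENNReal.rpow_mul,
    one_div_mul_eq_div] at h2

/-- If on a set of probability at least `p` the function `f` scales by `q` under a map that is
bounded on that set, then Jensen's inequality between its moments improves. -/
theorem lintegral_rpow_le_of_scaling {f : X → ℝ≥0∞} (hf : Measurable f) {S : X → X} {G : Set X}
    (hG : MeasurableSet G) {q K r s p : ℝ} (hq₀ : 0 ≤ q) (hq₁ : q ≤ 1) (hK : 0 ≤ K) (hr : 0 < r)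
    (hrs : r < s) (hS : ∀ x ∈ G, f (S x) = ENNReal.ofReal q * f x)
    (hSK : ∀ g : X → ℝ≥0∞, Measurable g →
      ∫⁻ x in G, g (S x) ∂μ ≤ ENNReal.ofReal K * ∫⁻ x, g x ∂μ)
    (hp : 0 ≤ p) (hpG : ENNReal.ofReal p ≤ μ G) :
    ∫⁻ x, f x ^ r ∂μ ≤
      ENNReal.ofReal (1 - r / s * (1 - r / s) * ((1 - q ^ (s / 2)) ^ 2 * p / (2 * (1 + K)))) *
        (∫⁻ x, f x ^ s ∂μ) ^ (r / s) := by
  have hs : 0 < s := hr.trans hrs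
  have hα₀ : 0 < r / s := div_pos hr hs
  have hα₁ : r / s < 1 := (div_lt_one hs).2 hrs
  set c := 1 - r / s * (1 - r / s) * ((1 - q ^ (s / 2)) ^ 2 * p / (2 * (1 + K))) with hc
  have hq2₀ : 0 ≤ q ^ (s / 2) := Real.rpow_nonneg hq₀ _
  have hq2₁ : q ^ (s / 2) ≤ 1 := Real.rpow_le_one hq₀ hq₁ (by positivity)
  have hp1 : p ≤ 1 := by
    have := hpG.trans prob_le_one
    exact (ENNReal.ofReal_le_one).1 this
  -- Needed when the s-th moment is infinite: the right side must then be ∞ and not 0 · ∞.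
  have hcpos : 0 < c := by
    have h1 : (1 - q ^ (s / 2)) ^ 2 * p / (2 * (1 + K)) ≤ 1 := by
      rw [div_le_one (by positivity)]
      have : (1 - q ^ (s / 2)) ^ 2 ≤ 1 := by
        rw [sq_le_one_iff_abs_le_one, abs_le]; constructor <;> linarith
      nlinarith
    have h2 : r / s * (1 - r / s) < 1 := by nlinarith
    have h3 : 0 ≤ (1 - q ^ (s / 2)) ^ 2 * p / (2 * (1 + K)) := by positivity
    have h4 : 0 ≤ r / s * (1 - r / s) := mul_nonneg hα₀.le (by linarith)
    nlinarith
  set E := ∫⁻ x, f x ^ s ∂μ with hE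
  by_cases hE0 : E = 0
  · have : ∫⁻ x, f x ^ r ∂μ = 0 := by
      refine le_antisymm ((lintegral_rpow_le_rpow_lintegral hf hr hrs.le).trans ?_) bot_le
      rw [← hE, hE0, ENNReal.zero_rpow_of_pos hα₀]
    rw [this]
    exact bot_le
  by_cases hEt : E = ∞
  · rw [hEt, ENNReal.top_rpow_of_pos hα₀, ENNReal.mul_top (by simpa using hcpos)]
    exact le_top
  -- normalise
  let y : X → ℝ := fun x => (f x ^ s / E).toReal
  have hy : Measurable y := by fun_prop
  have hy0 : ∀ x, 0 ≤ y x := fun x => ENNReal.toReal_nonneg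
  have hfin : ∀ᵐ x ∂μ, f x ^ s / E < ∞ := by
    have : ∀ᵐ x ∂μ, f x ^ s < ∞ := ae_lt_top (by fun_prop) hEt
    filter_upwards [this] with x hx using ENNReal.div_lt_top hx.ne hE0
  have hsq : ∀ x, Real.sqrt (y x) ^ 2 = y x := fun x => Real.sq_sqrt (hy0 x)
  have hone : ∫⁻ x, ENNReal.ofReal (Real.sqrt (y x) ^ 2) ∂μ = 1 := by
    calc ∫⁻ x, ENNReal.ofReal (Real.sqrt (y x) ^ 2) ∂μ = ∫⁻ x, f x ^ s / E ∂μ := by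
          refine lintegral_congr_ae ?_
          filter_upwards [hfin] with x hx
          rw [hsq, ENNReal.ofReal_toReal hx.ne]
      _ = 1 := by
          simp only [div_eq_mul_inv]
          rw [lintegral_mul_const _ (by fun_prop), ← hE, ENNReal.mul_inv_cancel hE0 hEt]
  -- The normalised function is f^s = z², so a factor q for f is a factor q^(s/2) for z.
  have hSz : ∀ x ∈ G, Real.sqrt (y (S x)) = q ^ (s / 2) * Real.sqrt (y x) := by
    intro x hx
    have : y (S x) = q ^ s * y x := by
      simp only [y]
      rw [hS x hx, ENNReal.mul_rpow_of_nonneg _ _ hs.le, mul_div_assoc, ENNReal.toReal_mul,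
        ENNReal.ofReal_rpow_of_nonneg hq₀ hs.le, ENNReal.toReal_ofReal (Real.rpow_nonneg hq₀ _)]
    rw [this, Real.sqrt_mul (Real.rpow_nonneg hq₀ _), Real.sqrt_eq_rpow (q ^ s), ← Real.rpow_mul hq₀]
    congr 2
    ring
  have main := lintegral_rpow_le_of_scaling_normalized (μ := μ) (z := fun x => Real.sqrt (y x))
    (by fun_prop) (fun x => Real.sqrt_nonneg _) hone hG hq2₀ hq2₁ hK hα₀ hα₁ hSz hSK hp hpG
  calc ∫⁻ x, f x ^ r ∂μ
      = ∫⁻ x, ENNReal.ofReal ((Real.sqrt (y x) ^ 2) ^ (r / s)) * E ^ (r / s) ∂μ := by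
        refine lintegral_congr_ae ?_
        filter_upwards [hfin] with x hx
        rw [hsq, ← ENNReal.ofReal_rpow_of_nonneg (hy0 x) hα₀.le, ENNReal.ofReal_toReal hx.ne,
          ← ENNReal.mul_rpow_of_nonneg _ _ hα₀.le, ENNReal.div_mul_cancel hE0 hEt,
          ← ENNReal.rpow_mul, mul_div_cancel₀ _ hs.ne']
    _ = (∫⁻ x, ENNReal.ofReal ((Real.sqrt (y x) ^ 2) ^ (r / s)) ∂μ) * E ^ (r / s) :=
        lintegral_mul_const _ (by fun_prop)
    _ ≤ ENNReal.ofReal c * E ^ (r / s) := by gcongr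

/-! ### Measurability of matrix operations -/

section Measurability

variable {X : Type*} [MeasurableSpace X] {l m n : Type*}

theorem measurable_matrix {f : X → Matrix m n ℂ} (h : ∀ i j, Measurable fun x => f x i j) :
    Measurable f :=
  measurable_pi_iff.2 fun i => measurable_pi_iff.2 fun j => h i j

theorem measurable_entry {f : X → Matrix m n ℂ} (h : Measurable f) (i : m) (j : n) :
    Measurable fun x => f x i j :=
  measurable_pi_iff.1 (measurable_pi_iff.1 h i) j

instance {m n : Type*} [Finite m] [Finite n] : SecondCountableTopology (Matrix m n ℂ) :=
  inferInstanceAs (SecondCountableTopology (m → n → ℂ))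

theorem _root_.Measurable.matrix_sub {f g : X → Matrix m n ℂ} (hf : Measurable f) (hg : Measurable g) :
    Measurable fun x => f x - g x :=
  measurable_matrix fun i j => (measurable_entry hf i j).sub (measurable_entry hg i j)

theorem _root_.Measurable.matrix_add {f g : X → Matrix m n ℂ} (hf : Measurable f) (hg : Measurable g) :
    Measurable fun x => f x + g x :=
  measurable_matrix fun i j => (measurable_entry hf i j).add (measurable_entry hg i j)

theorem _root_.Measurable.matrix_neg {f : X → Matrix m n ℂ} (hf : Measurable f) :
    Measurable fun x => - f x :=
  measurable_matrix fun i j => (measurable_entry hf i j).neg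

theorem _root_.Measurable.matrix_real_smul {f : X → Matrix m n ℂ} (hf : Measurable f) (c : ℝ) :
    Measurable fun x => c • f x :=
  measurable_matrix fun i j => (measurable_entry hf i j).const_smul c

theorem _root_.Measurable.matrix_conjTranspose {f : X → Matrix m n ℂ} (hf : Measurable f) :
    Measurable fun x => (f x)ᴴ :=
  measurable_matrix fun i j => Complex.continuous_conj.measurable.comp (measurable_entry hf j i)

theorem _root_.Measurable.matrix_mul [Fintype m] {f : X → Matrix l m ℂ} {g : X → Matrix m n ℂ}
    (hf : Measurable f) (hg : Measurable g) : Measurable fun x => f x * g x := by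
  refine measurable_matrix fun i j => ?_
  simp only [Matrix.mul_apply]
  exact Finset.measurable_sum _ fun k _ => (measurable_entry hf i k).mul (measurable_entry hg k j)

variable [Fintype n] [DecidableEq n]

theorem _root_.Measurable.matrix_inv {f : X → Matrix n n ℂ} (hf : Measurable f) :
    Measurable fun x => (f x)⁻¹ := by
  refine measurable_matrix fun i j => ?_
  have h1 : Measurable fun x => (f x).det := (Continuous.matrix_det continuous_id).measurable.comp hf
  have h2 : Measurable fun x => (f x).adjugate :=
    (Continuous.matrix_adjugate continuous_id).measurable.comp hf
  simp only [Matrix.inv_def, Matrix.smul_apply, Ring.inverse_eq_inv', smul_eq_mul]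
  exact h1.inv.mul (measurable_entry h2 i j)

theorem continuous_opNorm : Continuous (opNorm (ι := n)) := by
  refine Continuous.norm ?_
  exact (Matrix.toEuclideanCLM (n := n) (𝕜 := ℂ)).toAlgEquiv.toLinearMap.continuous_of_finiteDimensional

theorem _root_.Measurable.opNorm {f : X → Matrix n n ℂ} (hf : Measurable f) :
    Measurable fun x => BandMatrix.opNorm (f x) :=
  continuous_opNorm.measurable.comp hf

theorem _root_.Measurable.invNorm {f : X → Matrix n n ℂ} (hf : Measurable f) :
    Measurable fun x => BandMatrix.invNorm (f x) := by
  unfold BandMatrix.invNorm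
  refine Measurable.ite ?_ hf.matrix_inv.opNorm.ennreal_ofReal measurable_const
  have h1 : Measurable fun x => (f x).det := (Continuous.matrix_det continuous_id).measurable.comp hf
  have : {x | IsUnit (f x)} = (fun x => (f x).det) ⁻¹' {0}ᶜ := by
    ext x
    simp [Matrix.isUnit_iff_isUnit_det]
  rw [this]
  exact h1 (measurableSet_singleton 0).compl

theorem opNorm_nonneg (M : Matrix n n ℂ) : 0 ≤ opNorm M := norm_nonneg _

theorem opNorm_mul_le (M N : Matrix n n ℂ) : opNorm (M * N) ≤ opNorm M * opNorm N := by
  unfold opNorm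
  rw [map_mul]
  exact norm_mul_le _ _

theorem opNorm_sub_le (M N : Matrix n n ℂ) : opNorm (M - N) ≤ opNorm M + opNorm N := by
  unfold opNorm
  rw [map_sub]
  exact norm_sub_le _ _

theorem opNorm_conjTranspose (M : Matrix n n ℂ) : opNorm Mᴴ = opNorm M := by
  unfold opNorm
  rw [← Matrix.star_eq_conjTranspose, map_star, ContinuousLinearMap.star_eq_adjoint]
  exact LinearIsometryEquiv.norm_map ContinuousLinearMap.adjoint _

theorem opNorm_complex_smul (c : ℂ) (M : Matrix n n ℂ) : opNorm (c • M) = ‖c‖ * opNorm M := by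
  unfold opNorm
  rw [map_smul, norm_smul]

theorem opNorm_real_smul (c : ℝ) (M : Matrix n n ℂ) : opNorm (c • M) = |c| * opNorm M := by
  rw [show c • M = (c : ℂ) • M by ext; simp, opNorm_complex_smul, Complex.norm_real,
    Real.norm_eq_abs]

theorem opNorm_one_le : opNorm (1 : Matrix n n ℂ) ≤ 1 := by
  unfold opNorm
  rw [map_one]
  exact ContinuousLinearMap.norm_id_le

/-- Singular matrices have the value ∞, so a finite bound also certifies invertibility. -/
theorem isUnit_and_opNorm_inv_le {M : ℝ} (hM : 0 ≤ M) {Y : Matrix n n ℂ}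
    (h : ¬ ENNReal.ofReal M < invNorm Y) : IsUnit Y ∧ opNorm Y⁻¹ ≤ M := by
  unfold invNorm at h
  split_ifs at h with hu
  · exact ⟨hu, (ENNReal.ofReal_le_ofReal_iff hM).1 (not_lt.1 h)⟩
  · exact absurd ENNReal.ofReal_lt_top h

end Measurability

section Sets

variable {W : ℕ} (A : NonUnitalStarSubalgebra ℝ (Mat W))

theorem isClosed_herm : IsClosed (herm A : Set (Mat W)) :=
  (herm A).closed_of_finiteDimensional

theorem isClosed_coe (B : NonUnitalStarSubalgebra ℝ (Mat W)) : IsClosed (B : Set (Mat W)) :=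
  B.toNonUnitalSubalgebra.toSubmodule.closed_of_finiteDimensional

theorem isClosed_conjSet : IsClosed (conjSet A) := by
  have : conjSet A = ⋂ V ∈ A, (fun T : Mat W => Tᴴ * V * T) ⁻¹' (A : Set (Mat W)) := by
    ext T
    simp [conjSet]
  rw [this]
  refine isClosed_biInter fun V _ => (isClosed_coe A).preimage ?_
  fun_prop

end Sets

/-! ### Sequences of independent sites -/

section Cons

variable {Y : Type*} [MeasurableSpace Y]

/-- Put a point in front of a sequence. -/
def seqCons (y : Y) (x : ℕ → Y) : ℕ → Y := fun k => Nat.casesOn k y x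

theorem measurable_seqCons : Measurable fun p : Y × (ℕ → Y) => seqCons p.1 p.2 := by
  refine measurable_pi_iff.2 fun k => ?_
  cases k with
  | zero => exact measurable_fst
  | succ k => exact (measurable_pi_apply k).comp measurable_snd

theorem map_seqCons (π : Measure Y) [IsProbabilityMeasure π] :
    (π.prod (Measure.infinitePi fun _ : ℕ => π)).map (fun p => seqCons p.1 p.2) =
      Measure.infinitePi fun _ : ℕ => π := by
  classical
  refine Measure.eq_infinitePi _ fun s t ht => ?_
  obtain ⟨N, hN⟩ := s.exists_nat_subset_range
  -- Padding the cylinder with the whole space turns its index set into an initial segment, from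
  -- which the coordinate 0 splits off.
  let t' : ℕ → Set Y := fun i => if i ∈ s then t i else Set.univ
  have ht' : ∀ i, MeasurableSet (t' i) := fun i => by
    simp only [t']
    split_ifs
    exacts [ht i, .univ]
  have hsub : s ⊆ Finset.range (N + 1) := hN.trans (Finset.range_subset_range.2 N.le_succ)
  have hprod : ∏ i ∈ s, π (t i) = ∏ i ∈ Finset.range (N + 1), π (t' i) := by
    rw [← Finset.prod_subset hsub (f := fun i => π (t' i))]
    · exact Finset.prod_congr rfl fun i hi => by simp [t', hi]
    · intro i _ hi
      simp [t', hi]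
  have hset : (fun p : Y × (ℕ → Y) => seqCons p.1 p.2) ⁻¹' (Set.pi s t) =
      t' 0 ×ˢ Set.pi (Finset.range N) (fun i => t' (i + 1)) := by
    ext ⟨y, x⟩
    simp only [Set.mem_preimage, Set.mem_pi, Set.mem_prod, Finset.mem_coe]
    constructor
    · intro h
      refine ⟨?_, fun i _ => ?_⟩
      · simp only [t']
        split_ifs with h0
        exacts [h 0 h0, trivial]
      · simp only [t']
        split_ifs with h0
        exacts [h _ h0, trivial]
    · rintro ⟨h0, h1⟩ i hi
      cases i with
      | zero => simpa [t', hi, seqCons] using h0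
      | succ i =>
        have := h1 i (by have := hsub hi; simp at this ⊢; omega)
        simpa [t', hi, seqCons] using this
  rw [Measure.map_apply measurable_seqCons
    (MeasurableSet.pi s.countable_toSet fun i _ => ht i), hset, Measure.prod_prod,
    Measure.infinitePi_pi _ (fun i _ => ht' (i + 1)), hprod, Finset.prod_range_succ', mul_comm]

theorem lintegral_seqCons (π : Measure Y) [IsProbabilityMeasure π] {F : (ℕ → Y) → ℝ≥0∞}
    (hF : Measurable F) :
    ∫⁻ x, F x ∂(Measure.infinitePi fun _ : ℕ => π) =
      ∫⁻ y, ∫⁻ x, F (seqCons y x) ∂(Measure.infinitePi fun _ : ℕ => π) ∂π := by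
  conv_lhs => rw [← map_seqCons π]
  rw [lintegral_map hF measurable_seqCons, lintegral_prod]
  exact (hF.comp measurable_seqCons).aemeasurable

/-- Pairs of two independent i.i.d. sequences form an i.i.d. sequence. -/
theorem hasLaw_pairs {Ω : Type*} [MeasurableSpace Ω] {μ : Measure Ω} [IsProbabilityMeasure μ]
    {P Q : Measure Y} [IsProbabilityMeasure P] [IsProbabilityMeasure Q] {V T : ℕ → Ω → Y}
    (hV : ∀ k, HasLaw (V k) P μ) (hT : ∀ k, HasLaw (T k) Q μ)
    (h : iIndepFun (fun k : ℕ ⊕ ℕ => Sum.elim V T k) μ) :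
    HasLaw (fun ω k => (V k ω, T k ω)) (Measure.infinitePi fun _ : ℕ => P.prod Q) μ := by
  have hm : AEMeasurable (fun ω (k : ℕ ⊕ ℕ) => Sum.elim V T k ω) μ :=
    aemeasurable_pi_iff.2 fun k => by
      cases k
      exacts [(hV _).aemeasurable, (hT _).aemeasurable]
  have : ∀ k : ℕ ⊕ ℕ, IsProbabilityMeasure (Sum.elim (fun _ : ℕ => P) (fun _ : ℕ => Q) k) := by
    rintro (k | k)
    exacts [‹IsProbabilityMeasure P›, ‹IsProbabilityMeasure Q›]
  have hlaw : HasLaw (fun ω (k : ℕ ⊕ ℕ) => Sum.elim V T k ω)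
      (Measure.infinitePi (Sum.elim (fun _ : ℕ => P) (fun _ : ℕ => Q))) μ := by
    refine h.hasLaw_infinitePi ?_ hm
    rintro (k | k)
    exacts [hV k, hT k]
  have hg : Measurable fun (z : ℕ ⊕ ℕ → Y) (k : ℕ) => (z (Sum.inl k), z (Sum.inr k)) := by fun_prop
  refine ⟨hg.comp_aemeasurable hm, ?_⟩
  have hmap : (Measure.infinitePi (Sum.elim (fun _ : ℕ => P) (fun _ : ℕ => Q))).map
      (fun (z : ℕ ⊕ ℕ → Y) (k : ℕ) => (z (Sum.inl k), z (Sum.inr k))) =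
      Measure.infinitePi fun _ : ℕ => P.prod Q := by
    -- Reindexing by a Boolean label and currying groups the two variables of each site into one
    -- factor of the product measure.
    let e : ℕ × Bool → ℕ ⊕ ℕ := fun p => if p.2 then Sum.inr p.1 else Sum.inl p.1
    have he : Function.Injective e := by
      rintro ⟨i, a⟩ ⟨j, b⟩ hij
      cases a <;> cases b <;> simp_all [e]
    let R : ℕ → Bool → Measure Y := fun _ a => if a then Q else P
    have hR : ∀ i a, IsProbabilityMeasure (R i a) := by
      intro i a
      cases a
      exacts [‹IsProbabilityMeasure P›, ‹IsProbabilityMeasure Q›]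
    have h1 := Measure.map_infinitePi_infinitePi_of_inj
      (P := Sum.elim (fun _ : ℕ => P) (fun _ : ℕ => Q)) he
    have h2 : ∀ p : ℕ × Bool, Sum.elim (fun _ : ℕ => P) (fun _ : ℕ => Q) (e p) = R p.1 p.2 := by
      rintro ⟨i, a⟩
      cases a <;> rfl
    simp only [h2] at h1
    have h3 := Measure.infinitePi_map_curry R
    have h4 := Measure.infinitePi_map_pi (μ := fun i => Measure.infinitePi (R i))
      (f := fun (_ : ℕ) (z : Bool → Y) => (z false, z true)) (fun _ => by fun_prop)
    have h5 : ∀ i, (Measure.infinitePi (R i)).map (fun z : Bool → Y => (z false, z true)) =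
        P.prod Q := fun i => Measure.infinitePi_map_eval_prod Bool.false_ne_true
    simp only [h5] at h4
    rw [← h4, ← h3, ← h1, Measure.map_map (by fun_prop) (by fun_prop),
      Measure.map_map (by fun_prop) (by fun_prop)]
    rfl
  rw [← hmap, ← hlaw.map_eq, AEMeasurable.map_map_of_aemeasurable hg.aemeasurable hm]
  rfl

end Cons

/-! ### Affine changes of variables for a diagonal block -/

section Density

/-- Translation invariance removes d, and the dilation contributes c^(-D) ≤ 1 in every dimension. -/
theorem lintegral_comp_smul_add_le {D : ℕ} {K : (Fin D → ℝ) → ℝ≥0∞} (hK : Measurable K) {c : ℝ}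
    (hc : 1 ≤ c) (d : Fin D → ℝ) : ∫⁻ x, K (c • x + d) ≤ ∫⁻ x, K x := by
  have hc0 : c ≠ 0 := by linarith
  have h1 : ∫⁻ x, K (c • x + d) = ∫⁻ x, K (c • x) := by
    rw [← lintegral_add_right_eq_self (fun x => K (c • x)) (c⁻¹ • d)]
    refine lintegral_congr fun x => ?_
    rw [smul_add, smul_inv_smul₀ hc0]
  rw [h1, ← lintegral_map (f := K) (g := fun x => c • x) hK (by fun_prop),
    Measure.map_addHaar_smul _ hc0, lintegral_smul_measure]
  refine mul_le_of_le_one_left' (ENNReal.ofReal_le_one.2 ?_)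
  rw [abs_inv, abs_pow, abs_of_nonneg (by linarith)]
  exact inv_le_one_of_one_le₀ (one_le_pow₀ hc)

variable {W : ℕ} {A : NonUnitalStarSubalgebra ℝ (Mat W)}

theorem measurable_hermCoord : Measurable fun x : Fin (Module.finrank ℝ (herm A)) → ℝ =>
    ∑ k, x k • ((Module.finBasis ℝ (herm A) k : herm A) : Mat W) := by
  refine Continuous.measurable ?_
  fun_prop

theorem ae_mem_herm_hermVolume : ∀ᵐ V ∂(hermVolume A), V ∈ herm A := by
  refine (ae_map_iff (p := fun V => V ∈ herm A) measurable_hermCoord.aemeasurable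
    (isClosed_herm A).measurableSet).2 ?_
  exact .of_forall fun x => sum_mem fun k _ => (herm A).smul_mem _ (Subtype.prop _)

theorem lintegral_hermVolume_affine_le {k : Mat W → ℝ≥0∞} (hk : Measurable k) {c : ℝ} (hc : 1 ≤ c)
    {D : Mat W} (hD : D ∈ herm A) :
    ∫⁻ V, k (c • V + D) ∂(hermVolume A) ≤ ∫⁻ V, k V ∂(hermVolume A) := by
  have haff : Measurable fun V : Mat W => k (c • V + D) :=
    hk.comp ((measurable_id.matrix_real_smul c).matrix_add measurable_const)
  unfold hermVolume
  rw [lintegral_map haff measurable_hermCoord, lintegral_map hk measurable_hermCoord]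
  refine le_trans (le_of_eq ?_) (lintegral_comp_smul_add_le (hk.comp measurable_hermCoord) hc
    ((Module.finBasis ℝ (herm A)).repr ⟨D, hD⟩))
  refine lintegral_congr fun x => ?_
  have hDsum : D = ∑ i, (Module.finBasis ℝ (herm A)).repr ⟨D, hD⟩ i •
      ((Module.finBasis ℝ (herm A) i : herm A) : Mat W) := by
    have h := congrArg (herm A).subtype ((Module.finBasis ℝ (herm A)).sum_repr ⟨D, hD⟩)
    simp only [map_sum, map_smul, Submodule.subtype_apply] at h
    exact h.symm
  simp only [Function.comp_apply, Pi.add_apply, Pi.smul_apply, add_smul, smul_eq_mul, mul_smul,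
    Finset.sum_add_distrib, ← Finset.smul_sum, ← hDsum]

/-- The density at V is exchanged for the density at the image point, at the price δ⁻¹, before
changing variables in Lebesgue measure. -/
theorem setLIntegral_affine_le {ρ : Mat W → ℝ} (hρ : Measurable ρ) {δ : ℝ} (hδ : 0 < δ)
    {U : Set (Mat W)} (hU : MeasurableSet U) {c : ℝ} (hc : 1 ≤ c) {D : Mat W} (hD : D ∈ herm A)
    (hUρ : ∀ V ∈ U, δ * ρ V ≤ ρ (c • V + D)) {g : Mat W → ℝ≥0∞} (hg : Measurable g) :
    ∫⁻ V in U, g (c • V + D) ∂((hermVolume A).withDensity fun V => ENNReal.ofReal (ρ V)) ≤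
      ENNReal.ofReal δ⁻¹ *
        ∫⁻ V, g V ∂((hermVolume A).withDensity fun V => ENNReal.ofReal (ρ V)) := by
  have haff : Measurable fun V : Mat W => g (c • V + D) :=
    hg.comp ((measurable_id.matrix_real_smul c).matrix_add measurable_const)
  rw [restrict_withDensity hU, lintegral_withDensity_eq_lintegral_mul _ (by fun_prop)
    haff, lintegral_withDensity_eq_lintegral_mul _ (by fun_prop) hg]
  calc ∫⁻ V in U, ((fun V => ENNReal.ofReal (ρ V)) * fun V => g (c • V + D)) V ∂(hermVolume A)
      ≤ ∫⁻ V in U, ENNReal.ofReal δ⁻¹ *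
          (ENNReal.ofReal (ρ (c • V + D)) * g (c • V + D)) ∂(hermVolume A) := by
        refine setLIntegral_mono' hU fun V hV => ?_
        simp only [Pi.mul_apply]
        rw [← mul_assoc, ← ENNReal.ofReal_mul (inv_nonneg.2 hδ.le)]
        gcongr
        rw [le_inv_mul_iff₀ hδ]
        exact hUρ V hV
    _ ≤ ∫⁻ V, ENNReal.ofReal δ⁻¹ *
          (ENNReal.ofReal (ρ (c • V + D)) * g (c • V + D)) ∂(hermVolume A) :=
        setLIntegral_le_lintegral _ _
    _ ≤ ∫⁻ V, ENNReal.ofReal δ⁻¹ * (ENNReal.ofReal (ρ V) * g V) ∂(hermVolume A) :=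
        lintegral_hermVolume_affine_le
          (k := fun V => ENNReal.ofReal δ⁻¹ * (ENNReal.ofReal (ρ V) * g V)) (by fun_prop) hc hD
    _ = ENNReal.ofReal δ⁻¹ *
          ∫⁻ V, ((fun V => ENNReal.ofReal (ρ V)) * g) V ∂(hermVolume A) := by
        rw [lintegral_const_mul _ (by fun_prop)]
        rfl

end Density

/-! ### The gain from three consecutive sites -/

/-- Quantitative properties of the distributions of the blocks for one fixed `W`: `M` bounds
inverses, `N` the diagonal blocks and `τ` the off-diagonal blocks with good probability, and
`E` is the set where the density is regular at scale `ε`. -/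
structure RegularSite {W : ℕ} (A : NonUnitalStarSubalgebra ℝ (Mat W)) (P Q : Measure (Mat W))
    (lam M N τ ε δ p₀ q₀ : ℝ) (E : Set (Mat W)) : Prop where
  ae_herm : ∀ᵐ V ∂P, V ∈ herm A
  ae_conjSet : ∀ᵐ T ∂Q, T ∈ conjSet A
  ae_isUnit : ∀ B ∈ herm A, ∀ᵐ V ∂P, IsUnit (V - B)
  lam_mem : (lam : ℂ) • (1 : Mat W) ∈ herm A
  M_nonneg : 0 ≤ M
  p₀_pos : 0 < p₀
  q₀_pos : 0 < q₀
  δ_pos : 0 < δ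
  inv_bound : ∀ B ∈ herm A, P {V | ENNReal.ofReal M < invNorm (V - B)} ≤ ENNReal.ofReal (p₀ / 2)
  off_bound : ENNReal.ofReal q₀ ≤ Q {T | opNorm T ≤ τ}
  measurableSet : MeasurableSet E
  subset : E ⊆ (herm A : Set (Mat W))
  prob_le : ENNReal.ofReal p₀ ≤ P E
  diag_bound : ∀ V ∈ E, opNorm V ≤ N
  affine : ∀ U ⊆ E, MeasurableSet U → ∀ c : ℝ, 1 ≤ c → ∀ D ∈ herm A,
    (∀ V ∈ U, opNorm (c • V + D - V) ≤ ε) → ∀ g : Mat W → ℝ≥0∞, Measurable g →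
    ∫⁻ V in U, g (c • V + D) ∂P ≤ ENNReal.ofReal δ⁻¹ * ∫⁻ V, g V ∂P

section Sites

variable {W : ℕ}

/-- The self-energy that a site `y = (V, T)` with incoming self-energy `B` hands to its successor. -/
noncomputable def nextEnergy (lam : ℝ) (B : Mat W) (y : Mat W × Mat W) : Mat W :=
  y.2ᴴ * (y.1 - B - (lam : ℂ) • 1)⁻¹ * y.2

/-- The factor that a site contributes to an off-diagonal block of the resolvent. -/
noncomputable def hop (lam : ℝ) (B : Mat W) (y : Mat W × Mat W) : Mat W :=
  -((y.1 - B - (lam : ℂ) • 1)⁻¹ * y.2)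

theorem _root_.Measurable.nextEnergy {X : Type*} [MeasurableSpace X] (lam : ℝ) {B : X → Mat W}
    {y : X → Mat W × Mat W} (hB : Measurable B) (hy : Measurable y) :
    Measurable fun x => BandMatrix.nextEnergy lam (B x) (y x) :=
  ((hy.snd.matrix_conjTranspose).matrix_mul
    ((hy.fst.matrix_sub hB).matrix_sub measurable_const).matrix_inv).matrix_mul hy.snd

theorem _root_.Measurable.hop {X : Type*} [MeasurableSpace X] (lam : ℝ) {B : X → Mat W}
    {y : X → Mat W × Mat W} (hB : Measurable B) (hy : Measurable y) :
    Measurable fun x => BandMatrix.hop lam (B x) (y x) :=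
  ((((hy.fst.matrix_sub hB).matrix_sub measurable_const).matrix_inv).matrix_mul hy.snd).matrix_neg

variable {A : NonUnitalStarSubalgebra ℝ (Mat W)} {P Q : Measure (Mat W)}
  {lam M N τ ε δ p₀ q₀ : ℝ} {E : Set (Mat W)}

theorem nextEnergy_mem (hlam : (lam : ℂ) • (1 : Mat W) ∈ herm A) {B : Mat W} (hB : B ∈ herm A)
    {y : Mat W × Mat W} (h₁ : y.1 ∈ herm A) (h₂ : y.2 ∈ conjSet A) :
    nextEnergy lam B y ∈ herm A :=
  conj_mem_herm h₂ (inv_mem_herm ((herm A).sub_mem ((herm A).sub_mem h₁ hB) hlam))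

theorem opNorm_nextEnergy_le (hM : 0 ≤ M) {B : Mat W} {y : Mat W × Mat W}
    (h₁ : ¬ ENNReal.ofReal M < invNorm (y.1 - B - (lam : ℂ) • 1)) (h₂ : opNorm y.2 ≤ τ) :
    opNorm (nextEnergy lam B y) ≤ τ ^ 2 * M := by
  have h3 := (isUnit_and_opNorm_inv_le hM h₁).2
  have hτ : 0 ≤ τ := (opNorm_nonneg _).trans h₂
  calc opNorm (nextEnergy lam B y)
      ≤ opNorm (y.2ᴴ * (y.1 - B - (lam : ℂ) • 1)⁻¹) * opNorm y.2 := opNorm_mul_le _ _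
    _ ≤ (opNorm y.2ᴴ * opNorm (y.1 - B - (lam : ℂ) • 1)⁻¹) * opNorm y.2 := by
        gcongr
        · exact opNorm_nonneg _
        · exact opNorm_mul_le _ _
    _ ≤ (τ * M) * τ := by
        rw [opNorm_conjTranspose]
        gcongr
        · exact opNorm_nonneg _
        · exact opNorm_nonneg _
    _ = τ ^ 2 * M := by ring

/-- Scaling the inverse pivot of a site by `c`. -/
noncomputable def scaleSite (lam c : ℝ) (B : Mat W) (y : Mat W × Mat W) : Mat W × Mat W :=
  (c • y.1 + (1 - c) • (B + (lam : ℂ) • 1), y.2)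

theorem scaleSite_pivot (c : ℝ) (B : Mat W) (y : Mat W × Mat W) :
    (scaleSite lam c B y).1 - B - (lam : ℂ) • 1 = c • (y.1 - B - (lam : ℂ) • 1) := by
  simp only [scaleSite]
  module

theorem nextEnergy_scaleSite {c : ℝ} (hc : c ≠ 0) (B : Mat W) (y : Mat W × Mat W) :
    nextEnergy lam B (scaleSite lam c B y) = c⁻¹ • nextEnergy lam B y := by
  simp only [nextEnergy]
  rw [scaleSite_pivot, smul_inv_of_ne_zero hc, mul_smul_comm, smul_mul_assoc]
  rfl

theorem hop_scaleSite {c : ℝ} (hc : c ≠ 0) (B : Mat W) (y : Mat W × Mat W) :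
    hop lam B (scaleSite lam c B y) = c⁻¹ • hop lam B y := by
  simp only [hop]
  rw [scaleSite_pivot, smul_inv_of_ne_zero hc, smul_mul_assoc, smul_neg]
  rfl

/-- Shifting a site so that its pivot does not notice that the incoming self-energy `B` is
multiplied by `a`. -/
noncomputable def shiftSite (a : ℝ) (B : Mat W) (y : Mat W × Mat W) : Mat W × Mat W :=
  (y.1 + (a - 1) • B, y.2)

theorem shiftSite_pivot (a : ℝ) (B : Mat W) (y : Mat W × Mat W) :
    (shiftSite a B y).1 - a • B - (lam : ℂ) • 1 = y.1 - B - (lam : ℂ) • 1 := by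
  simp only [shiftSite]
  module

theorem nextEnergy_shiftSite (a : ℝ) (B : Mat W) (y : Mat W × Mat W) :
    nextEnergy lam (a • B) (shiftSite a B y) = nextEnergy lam B y := by
  simp only [nextEnergy]
  rw [shiftSite_pivot]
  rfl

theorem hop_shiftSite (a : ℝ) (B : Mat W) (y : Mat W × Mat W) :
    hop lam (a • B) (shiftSite a B y) = hop lam B y := by
  simp only [hop]
  rw [shiftSite_pivot]
  rfl

/-- The off-diagonal block does not move, so the estimate for one diagonal block applies after
averaging over T. -/
theorem RegularSite.site_affine [IsProbabilityMeasure P] [IsProbabilityMeasure Q]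
    (h : RegularSite A P Q lam M N τ ε δ p₀ q₀ E)
    {U : Set (Mat W)} (hUE : U ⊆ E) (hU : MeasurableSet U) {c : ℝ} (hc : 1 ≤ c) {D : Mat W} (hD : D ∈ herm A)
    (hUD : ∀ V ∈ U, opNorm (c • V + D - V) ≤ ε) {g : Mat W × Mat W → ℝ≥0∞} (hg : Measurable g) :
    ∫⁻ y in Prod.fst ⁻¹' U, g (c • y.1 + D, y.2) ∂(P.prod Q) ≤
      ENNReal.ofReal δ⁻¹ * ∫⁻ y, g y ∂(P.prod Q) := by
  have haff : Measurable fun y : Mat W × Mat W => g (c • y.1 + D, y.2) :=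
    hg.comp (((measurable_fst.matrix_real_smul c).matrix_add measurable_const).prodMk measurable_snd)
  have hset : (Prod.fst ⁻¹' U : Set (Mat W × Mat W)) = U ×ˢ Set.univ := by ext; simp
  rw [hset, ← Measure.prod_restrict, Measure.restrict_univ,
    lintegral_prod _ haff.aemeasurable,
    lintegral_prod _ hg.aemeasurable]
  exact h.affine U hUE hU c hc D hD hUD (fun V => ∫⁻ T, g (V, T) ∂Q) hg.lintegral_prod_right'

/-- The sites at which the pivot and the off-diagonal block are bounded. -/
def boundedSite (A : NonUnitalStarSubalgebra ℝ (Mat W)) (lam M τ : ℝ) (E : Set (Mat W))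
    (B : Mat W) : Set (Mat W × Mat W) :=
  (E ∩ {V | ¬ ENNReal.ofReal M < invNorm (V - (B + (lam : ℂ) • 1))}) ×ˢ
    (conjSet A ∩ {T | opNorm T ≤ τ})

theorem RegularSite.off_prob (h : RegularSite A P Q lam M N τ ε δ p₀ q₀ E) :
    ENNReal.ofReal q₀ ≤ Q (conjSet A ∩ {T | opNorm T ≤ τ}) := by
  refine h.off_bound.trans (measure_mono_ae ?_)
  filter_upwards [h.ae_conjSet] with T hT hT2 using ⟨hT, hT2⟩

/-- The Wegner bound, uniform in the shift, removes at most p₀/2 from the event for V; T is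
independent of V. The relevant cases are all hermitian V, with p = 1, and the regular set, with p =
p₀. -/
theorem RegularSite.boundedSite_prob [IsProbabilityMeasure Q]
    (h : RegularSite A P Q lam M N τ ε δ p₀ q₀ E)
    {F : Set (Mat W)} {p : ℝ} (hp : ENNReal.ofReal p ≤ P F) {B : Mat W}
    (hB : B ∈ herm A) :
    ENNReal.ofReal (p - p₀ / 2) * ENNReal.ofReal q₀ ≤ P.prod Q (boundedSite A lam M τ F B) := by
  rw [boundedSite, Measure.prod_prod]
  refine mul_le_mul' ?_ h.off_prob
  have h1 := h.inv_bound _ ((herm A).add_mem hB h.lam_mem)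
  rw [ENNReal.ofReal_sub _ (by linarith [h.p₀_pos])]
  refine le_trans (tsub_le_tsub hp h1) ?_
  refine le_trans (le_measure_sdiff) (measure_mono ?_)
  rintro V ⟨h1, h2⟩
  exact ⟨h1, h2⟩

theorem measurableSet_boundedSite {X : Type*} [MeasurableSpace X] {F : Set (Mat W)}
    (hF : MeasurableSet F) {B : X → Mat W} (hB : Measurable B) :
    MeasurableSet {p : X × (Mat W × Mat W) | p.2 ∈ boundedSite A lam M τ F (B p.1)} := by
  have h1 : MeasurableSet {p : X × (Mat W × Mat W) | p.2.1 ∈ F} :=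
    measurable_snd.fst hF
  have h2 : MeasurableSet {p : X × (Mat W × Mat W) |
      ¬ ENNReal.ofReal M < invNorm (p.2.1 - (B p.1 + (lam : ℂ) • 1))} := by
    have h : Measurable fun p : X × (Mat W × Mat W) =>
        invNorm (p.2.1 - (B p.1 + (lam : ℂ) • 1)) :=
      (measurable_snd.fst.matrix_sub
        ((hB.comp measurable_fst).matrix_add measurable_const)).invNorm
    exact (measurableSet_lt measurable_const h).compl
  have h3 : MeasurableSet {p : X × (Mat W × Mat W) | p.2.2 ∈ conjSet A} :=
    measurable_snd.snd (isClosed_conjSet A).measurableSet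
  have h4 : MeasurableSet {p : X × (Mat W × Mat W) | opNorm p.2.2 ≤ τ} :=
    measurableSet_le measurable_snd.snd.opNorm measurable_const
  exact (h1.inter h2).inter (h3.inter h4)

end Sites

/-! ### Scaling the product of three hops -/

section Block

variable {W : ℕ} {A : NonUnitalStarSubalgebra ℝ (Mat W)} {P Q : Measure (Mat W)}
  {lam M N τ ε δ p₀ q₀ : ℝ} {E : Set (Mat W)}

/-- The contribution of three consecutive sites, paired with the outgoing self-energy. -/
noncomputable def threeSites (lam : ℝ) (B : Mat W)
    (x : (Mat W × Mat W) × (Mat W × Mat W) × (Mat W × Mat W)) : Mat W × Mat W :=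
  (hop lam B x.1 * (hop lam (nextEnergy lam B x.1) x.2.1 *
      hop lam (nextEnergy lam (nextEnergy lam B x.1) x.2.1) x.2.2),
    nextEnergy lam (nextEnergy lam (nextEnergy lam B x.1) x.2.1) x.2.2)

theorem measurable_threeSites (B : Mat W) : Measurable (threeSites lam B) := by
  have h1 : Measurable fun x : (Mat W × Mat W) × (Mat W × Mat W) × (Mat W × Mat W) =>
      nextEnergy lam B x.1 := Measurable.nextEnergy lam measurable_const measurable_fst
  have h2 := Measurable.nextEnergy lam h1 measurable_snd.fst
  exact ((Measurable.hop lam measurable_const measurable_fst).matrix_mul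
    ((Measurable.hop lam h1 measurable_snd.fst).matrix_mul
      (Measurable.hop lam h2 measurable_snd.snd))).prodMk
    (Measurable.nextEnergy lam h2 measurable_snd.snd)

/-- Scaling of the middle site, compensated at the last site. -/
noncomputable def scaleMiddle (lam c : ℝ) (B : Mat W)
    (x : (Mat W × Mat W) × (Mat W × Mat W) × (Mat W × Mat W)) :
    (Mat W × Mat W) × (Mat W × Mat W) × (Mat W × Mat W) :=
  (x.1, scaleSite lam c (nextEnergy lam B x.1) x.2.1,
    shiftSite c⁻¹ (nextEnergy lam (nextEnergy lam B x.1) x.2.1) x.2.2)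

/-- The middle hop gains c⁻¹, and so does the energy that it hands on; the shift of the last site
hides the latter. No pivot has to be invertible, because nonsingular inverses commute with nonzero
scalars in all cases. -/
theorem threeSites_scaleMiddle {c : ℝ} (hc : c ≠ 0) (B : Mat W)
    (x : (Mat W × Mat W) × (Mat W × Mat W) × (Mat W × Mat W)) :
    threeSites lam B (scaleMiddle lam c B x) =
      (c⁻¹ • (threeSites lam B x).1, (threeSites lam B x).2) := by
  simp only [threeSites, scaleMiddle, nextEnergy_scaleSite hc, hop_scaleSite hc,
    nextEnergy_shiftSite, hop_shiftSite, smul_mul_assoc, mul_smul_comm]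

theorem measurable_scaleSite {X : Type*} [MeasurableSpace X] (c : ℝ) {B : X → Mat W}
    {y : X → Mat W × Mat W} (hB : Measurable B) (hy : Measurable y) :
    Measurable fun x => scaleSite lam c (B x) (y x) :=
  ((hy.fst.matrix_real_smul c).matrix_add
    ((hB.matrix_add measurable_const).matrix_real_smul (1 - c))).prodMk hy.snd

theorem measurable_shiftSite {X : Type*} [MeasurableSpace X] (a : ℝ) {B : X → Mat W}
    {y : X → Mat W × Mat W} (hB : Measurable B) (hy : Measurable y) :
    Measurable fun x => shiftSite a (B x) (y x) :=
  (hy.fst.matrix_add (hB.matrix_real_smul (a - 1))).prodMk hy.snd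

theorem measurable_scaleMiddle (c : ℝ) (B : Mat W) : Measurable (scaleMiddle lam c B) := by
  have h1 : Measurable fun x : (Mat W × Mat W) × (Mat W × Mat W) × (Mat W × Mat W) =>
      nextEnergy lam B x.1 := Measurable.nextEnergy lam measurable_const measurable_fst
  exact measurable_fst.prodMk ((measurable_scaleSite c h1 measurable_snd.fst).prodMk
    (measurable_shiftSite _ (Measurable.nextEnergy lam h1 measurable_snd.fst) measurable_snd.snd))

/-- The event on which three sites can be scaled. -/
def goodSites (A : NonUnitalStarSubalgebra ℝ (Mat W)) (lam M τ : ℝ) (E : Set (Mat W))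
    (B : Mat W) : Set ((Mat W × Mat W) × (Mat W × Mat W) × (Mat W × Mat W)) :=
  -- The first site only has to keep the energy entering the middle site bounded, and the middle
  -- site does the same for the last. Regularity of the density matters only at the two sites that
  -- move.
  {x | x.1 ∈ boundedSite A lam M τ (herm A) B ∧
    x.2.1 ∈ boundedSite A lam M τ E (nextEnergy lam B x.1) ∧ x.2.2.1 ∈ E}

theorem measurableSet_goodSites (hE : MeasurableSet E) (B : Mat W) :
    MeasurableSet (goodSites A lam M τ E B) := by
  have h1 : MeasurableSet {x : (Mat W × Mat W) × (Mat W × Mat W) × (Mat W × Mat W) |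
      x.1 ∈ boundedSite A lam M τ (herm A) B} := by
    have := measurableSet_boundedSite (X := Unit) (A := A) (lam := lam) (M := M) (τ := τ)
      (isClosed_herm A).measurableSet (B := fun _ => B) measurable_const
    exact (measurable_const (a := ()).prodMk measurable_fst) this
  have h2 : MeasurableSet {x : (Mat W × Mat W) × (Mat W × Mat W) × (Mat W × Mat W) |
      x.2.1 ∈ boundedSite A lam M τ E (nextEnergy lam B x.1)} := by
    have := measurableSet_boundedSite (X := Mat W × Mat W) (A := A) (lam := lam) (M := M) (τ := τ)
      hE (B := fun y => nextEnergy lam B y) (Measurable.nextEnergy lam measurable_const measurable_id)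
    exact (measurable_fst.prodMk measurable_snd.fst) this
  exact h1.inter (h2.inter (measurable_snd.snd.fst hE))

variable [IsProbabilityMeasure P] [IsProbabilityMeasure Q]

/-- Each condition is integrated given the earlier sites, with a lower bound that does not depend on
the incoming energy: (1 - p₀/2)q₀ for the first site, (p₀/2)q₀ for the middle one, p₀ for the last.
-/
theorem RegularSite.goodSites_prob (h : RegularSite A P Q lam M N τ ε δ p₀ q₀ E) {B : Mat W}
    (hB : B ∈ herm A) :
    ENNReal.ofReal ((1 - p₀ / 2) * q₀ * ((p₀ / 2) * q₀ * p₀)) ≤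
      (P.prod Q).prod ((P.prod Q).prod (P.prod Q)) (goodSites A lam M τ E B) := by
  have hp1 : p₀ ≤ 1 := ENNReal.ofReal_le_one.1 (h.prob_le.trans prob_le_one)
  have hp := h.p₀_pos
  have hq := h.q₀_pos
  have hherm : ENNReal.ofReal 1 ≤ P (herm A) := by
    rw [ENNReal.ofReal_one, (prob_compl_eq_zero_iff (isClosed_herm A).measurableSet).1 h.ae_herm]
  have h0 := h.boundedSite_prob (lam := lam) hherm hB
  rw [Measure.prod_apply (measurableSet_goodSites h.measurableSet B)]
  calc ENNReal.ofReal ((1 - p₀ / 2) * q₀ * ((p₀ / 2) * q₀ * p₀))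
      = (ENNReal.ofReal (p₀ / 2) * ENNReal.ofReal q₀ * ENNReal.ofReal p₀) *
        (ENNReal.ofReal (1 - p₀ / 2) * ENNReal.ofReal q₀) := by
        rw [← ENNReal.ofReal_mul (by positivity), ← ENNReal.ofReal_mul (by positivity),
          ← ENNReal.ofReal_mul (by linarith), ← ENNReal.ofReal_mul (by positivity)]
        congr 1
        ring
    _ ≤ (ENNReal.ofReal (p₀ / 2) * ENNReal.ofReal q₀ * ENNReal.ofReal p₀) *
        P.prod Q (boundedSite A lam M τ (herm A) B) := by gcongr
    _ = ∫⁻ _ in boundedSite A lam M τ (herm A) B,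
        (ENNReal.ofReal (p₀ / 2) * ENNReal.ofReal q₀ * ENNReal.ofReal p₀) ∂(P.prod Q) :=
        (setLIntegral_const _ _).symm
    _ ≤ ∫⁻ y in boundedSite A lam M τ (herm A) B, (P.prod Q).prod (P.prod Q)
        (Prod.mk y ⁻¹' goodSites A lam M τ E B) ∂(P.prod Q) := by
        refine setLIntegral_mono_ae' ?_ (.of_forall fun y hy => ?_)
        · exact (measurable_const (a := ()).prodMk measurable_id)
            (measurableSet_boundedSite (X := Unit) (A := A) (lam := lam) (M := M) (τ := τ)
              (isClosed_herm A).measurableSet (B := fun _ => B) measurable_const)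
        · have hB1 := nextEnergy_mem h.lam_mem hB hy.1.1 hy.2.1
          have h1 := h.boundedSite_prob (lam := lam) h.prob_le hB1
          have hset : Prod.mk y ⁻¹' goodSites A lam M τ E B =
              boundedSite A lam M τ E (nextEnergy lam B y) ×ˢ (E ×ˢ Set.univ) := by
            ext ⟨y1, y2⟩
            simp [goodSites, hy]
          rw [hset, Measure.prod_prod, Measure.prod_prod, measure_univ, mul_one]
          refine mul_le_mul' ?_ h.prob_le
          rwa [sub_half] at h1
    _ ≤ _ := setLIntegral_le_lintegral _ _

/-- The map is triangular: for fixed earlier sites, the last block is translated by a constant and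
the middle block undergoes an affine dilation. Integrating the last site first costs δ⁻¹, and the
middle one costs another δ⁻¹. -/
theorem RegularSite.scaleMiddle_bound (h : RegularSite A P Q lam M N τ ε δ p₀ q₀ E) {c : ℝ}
    (hc : 1 ≤ c) (hcε : (c - 1) * (N + τ ^ 2 * M + |lam|) ≤ ε) {B : Mat W} (hB : B ∈ herm A)
    {g : (Mat W × Mat W) × (Mat W × Mat W) × (Mat W × Mat W) → ℝ≥0∞} (hg : Measurable g) :
    ∫⁻ x in goodSites A lam M τ E B, g (scaleMiddle lam c B x)
        ∂((P.prod Q).prod ((P.prod Q).prod (P.prod Q))) ≤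
      ENNReal.ofReal (δ⁻¹ * δ⁻¹) * ∫⁻ x, g x ∂((P.prod Q).prod ((P.prod Q).prod (P.prod Q))) := by
  have hG := measurableSet_goodSites (A := A) (lam := lam) (M := M) (τ := τ) h.measurableSet B
  have hgS := hg.comp (measurable_scaleMiddle (lam := lam) c B)
  change ∫⁻ x in goodSites A lam M τ E B, (g ∘ scaleMiddle lam c B) x ∂_ ≤ _
  rw [← lintegral_indicator hG, lintegral_prod _ ((hgS.indicator hG).aemeasurable),
    lintegral_prod _ hg.aemeasurable, ← lintegral_const_mul _ hg.lintegral_prod_right']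
  refine lintegral_mono fun y => ?_
  by_cases hy : y ∈ boundedSite A lam M τ (herm A) B
  swap
  · refine le_trans (le_of_eq ?_) bot_le
    refine (lintegral_congr fun z => ?_).trans lintegral_zero
    exact Set.indicator_of_notMem (fun hz => hy hz.1) _
  have hδ := h.δ_pos
  obtain ⟨B₁, hB₁⟩ : ∃ B₁, B₁ = nextEnergy lam B y := ⟨_, rfl⟩
  have hB₁mem : B₁ ∈ herm A := hB₁ ▸ nextEnergy_mem h.lam_mem hB hy.1.1 hy.2.1
  have hB₁norm : opNorm B₁ ≤ τ ^ 2 * M := by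
    rw [hB₁]
    refine opNorm_nextEnergy_le h.M_nonneg ?_ hy.2.2
    rw [sub_sub]
    exact hy.1.2
  have hgy : Measurable fun z => g (y, z) := hg.comp measurable_prodMk_left
  -- the last site
  have hlast : ∀ y₁ ∈ boundedSite A lam M τ E B₁, ∀ k : Mat W × Mat W → ℝ≥0∞, Measurable k →
      ∫⁻ y₂ in Prod.fst ⁻¹' E, k (shiftSite c⁻¹ (nextEnergy lam B₁ y₁) y₂) ∂(P.prod Q) ≤
        ENNReal.ofReal δ⁻¹ * ∫⁻ y₂, k y₂ ∂(P.prod Q) := by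
    intro y₁ hy₁ k hk
    have hB₂ := nextEnergy_mem h.lam_mem hB₁mem (h.subset hy₁.1.1) hy₁.2.1
    have hB₂norm : opNorm (nextEnergy lam B₁ y₁) ≤ τ ^ 2 * M := by
      refine opNorm_nextEnergy_le h.M_nonneg ?_ hy₁.2.2
      rw [sub_sub]
      exact hy₁.1.2
    have := h.site_affine subset_rfl h.measurableSet le_rfl
      ((herm A).smul_mem (c⁻¹ - 1) hB₂) (fun V hV => ?_) hk
    · simpa only [one_smul] using! this
    · rw [one_smul, add_sub_cancel_left, opNorm_real_smul]
      refine le_trans ?_ hcε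
      -- The translation of the last site is therefore controlled by the same smallness condition as
      -- the dilation.
      have h1 : |c⁻¹ - 1| ≤ c - 1 := by
        have hc0 : 0 < c := by linarith
        have h2 : c⁻¹ ≤ 1 := inv_le_one_of_one_le₀ hc
        rw [abs_of_nonpos (by linarith)]
        have h3 : c * c⁻¹ = 1 := mul_inv_cancel₀ hc0.ne'
        nlinarith
      have hN : 0 ≤ N := (opNorm_nonneg _).trans (h.diag_bound V hV)
      refine mul_le_mul h1 ?_ (opNorm_nonneg _) (by linarith)
      linarith [abs_nonneg lam]
  -- the middle site
  have hmid : ∀ k : Mat W × Mat W → ℝ≥0∞, Measurable k →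
      ∫⁻ y₁ in boundedSite A lam M τ E B₁, k (scaleSite lam c B₁ y₁) ∂(P.prod Q) ≤
        ENNReal.ofReal δ⁻¹ * ∫⁻ y₁, k y₁ ∂(P.prod Q) := by
    intro k hk
    have := h.site_affine subset_rfl h.measurableSet hc
      ((herm A).smul_mem (1 - c) ((herm A).add_mem hB₁mem h.lam_mem)) (fun V hV => ?_) hk
    · refine le_trans (lintegral_mono_set ?_) this
      exact fun y₁ hy₁ => hy₁.1.1
    -- The displacement is (c - 1) times the pivot, whence the sum of three norms in the smallness
    -- condition.
    · have : c • V + (1 - c) • (B₁ + (lam : ℂ) • 1) - V = (c - 1) • (V - B₁ - (lam : ℂ) • 1) := by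
        module
      rw [this, opNorm_real_smul, abs_of_nonneg (by linarith)]
      refine le_trans ?_ hcε
      refine mul_le_mul_of_nonneg_left ?_ (by linarith)
      calc opNorm (V - B₁ - (lam : ℂ) • 1) ≤ opNorm V + opNorm B₁ + opNorm ((lam : ℂ) • (1 : Mat W)) :=
            (opNorm_sub_le _ _).trans (add_le_add (opNorm_sub_le _ _) le_rfl)
        _ ≤ N + τ ^ 2 * M + |lam| := by
            refine add_le_add (add_le_add (h.diag_bound V hV) hB₁norm) ?_
            rw [opNorm_complex_smul, Complex.norm_real, Real.norm_eq_abs]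
            exact mul_le_of_le_one_right (abs_nonneg _) opNorm_one_le
  have hb : MeasurableSet (boundedSite A lam M τ E B₁) :=
    (measurable_const (a := ()).prodMk measurable_id)
      (measurableSet_boundedSite (X := Unit) (A := A) (lam := lam) (M := M) (τ := τ)
        h.measurableSet (B := fun _ => B₁) measurable_const)
  have hEm : MeasurableSet (Prod.fst ⁻¹' E : Set (Mat W × Mat W)) := measurable_fst h.measurableSet
  have hm2 : Measurable fun z => (goodSites A lam M τ E B).indicator
      (g ∘ scaleMiddle lam c B) (y, z) := (hgS.indicator hG).comp measurable_prodMk_left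
  calc ∫⁻ z, (goodSites A lam M τ E B).indicator (g ∘ scaleMiddle lam c B) (y, z)
        ∂((P.prod Q).prod (P.prod Q))
      = ∫⁻ y₁, ∫⁻ y₂, (goodSites A lam M τ E B).indicator (g ∘ scaleMiddle lam c B) (y, y₁, y₂)
        ∂(P.prod Q) ∂(P.prod Q) := lintegral_prod _ hm2.aemeasurable
    _ = ∫⁻ y₁ in boundedSite A lam M τ E B₁, ∫⁻ y₂ in Prod.fst ⁻¹' E,
        g (y, scaleSite lam c B₁ y₁, shiftSite c⁻¹ (nextEnergy lam B₁ y₁) y₂)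
        ∂(P.prod Q) ∂(P.prod Q) := by
        rw [← lintegral_indicator hb]
        refine lintegral_congr fun y₁ => ?_
        by_cases hy₁ : y₁ ∈ boundedSite A lam M τ E B₁
        · rw [Set.indicator_of_mem hy₁, ← lintegral_indicator hEm]
          refine lintegral_congr fun y₂ => ?_
          by_cases hy₂ : y₂.1 ∈ E
          · rw [Set.indicator_of_mem (show (y, y₁, y₂) ∈ goodSites A lam M τ E B from
              ⟨hy, hB₁ ▸ hy₁, hy₂⟩), Set.indicator_of_mem (show y₂ ∈ Prod.fst ⁻¹' E from hy₂)]
            simp only [Function.comp_apply, scaleMiddle, hB₁]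
          · rw [Set.indicator_of_notMem (fun hz => hy₂ hz.2.2),
              Set.indicator_of_notMem (show y₂ ∉ Prod.fst ⁻¹' E from hy₂)]
        · rw [Set.indicator_of_notMem hy₁]
          refine (lintegral_congr fun y₂ => ?_).trans lintegral_zero
          exact Set.indicator_of_notMem (fun hz => hy₁ (hB₁ ▸ hz.2.1)) _
    _ ≤ ∫⁻ y₁ in boundedSite A lam M τ E B₁, ENNReal.ofReal δ⁻¹ *
        ∫⁻ y₂, g (y, scaleSite lam c B₁ y₁, y₂) ∂(P.prod Q) ∂(P.prod Q) :=
        setLIntegral_mono' hb fun y₁ hy₁ => hlast y₁ hy₁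
          (fun y₂ => g (y, scaleSite lam c B₁ y₁, y₂)) (hgy.comp measurable_prodMk_left)
    _ ≤ ENNReal.ofReal δ⁻¹ * ∫⁻ y₁, ENNReal.ofReal δ⁻¹ * ∫⁻ y₂, g (y, y₁, y₂)
        ∂(P.prod Q) ∂(P.prod Q) :=
        hmid (fun y₁ => ENNReal.ofReal δ⁻¹ * ∫⁻ y₂, g (y, y₁, y₂) ∂(P.prod Q))
          (measurable_const.mul hgy.lintegral_prod_right')
    _ = ENNReal.ofReal (δ⁻¹ * δ⁻¹) * ∫⁻ z, g (y, z) ∂((P.prod Q).prod (P.prod Q)) := by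
        rw [lintegral_const_mul _ hgy.lintegral_prod_right', lintegral_prod _ hgy.aemeasurable,
          ← mul_assoc, ← ENNReal.ofReal_mul (inv_nonneg.2 hδ.le)]

/-- The moment inequality for three consecutive sites. -/
theorem RegularSite.threeSites_moment (h : RegularSite A P Q lam M N τ ε δ p₀ q₀ E) {c : ℝ}
    (hc : 1 ≤ c) (hcε : (c - 1) * (N + τ ^ 2 * M + |lam|) ≤ ε) {r s : ℝ} (hr : 0 < r) (hrs : r < s)
    {B : Mat W} (hB : B ∈ herm A) {F : Mat W × Mat W → ℝ≥0∞} (hF : Measurable F)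
    (hhom : ∀ a : ℝ, 0 < a → ∀ Y B', F (a • Y, B') = ENNReal.ofReal a * F (Y, B')) :
    ∫⁻ x, F (threeSites lam B x) ^ r ∂((P.prod Q).prod ((P.prod Q).prod (P.prod Q))) ≤
      ENNReal.ofReal (1 - r / s * (1 - r / s) * ((1 - c⁻¹ ^ (s / 2)) ^ 2 *
        ((1 - p₀ / 2) * q₀ * ((p₀ / 2) * q₀ * p₀)) / (2 * (1 + δ⁻¹ * δ⁻¹)))) *
      (∫⁻ x, F (threeSites lam B x) ^ s
        ∂((P.prod Q).prod ((P.prod Q).prod (P.prod Q)))) ^ (r / s) := by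
  have hp1 : p₀ ≤ 1 := ENNReal.ofReal_le_one.1 (h.prob_le.trans prob_le_one)
  have hp := h.p₀_pos
  have hq := h.q₀_pos
  have hc0 : 0 < c := by linarith
  refine lintegral_rpow_le_of_scaling (hF.comp (measurable_threeSites B))
    (S := scaleMiddle lam c B) (measurableSet_goodSites h.measurableSet B)
    (inv_nonneg.2 hc0.le) (inv_le_one_of_one_le₀ hc) (mul_self_nonneg _) hr hrs ?_
    (fun g hg => h.scaleMiddle_bound hc hcε hB hg) ?_ (h.goodSites_prob hB)
  · intro x _
    rw [Function.comp_apply, threeSites_scaleMiddle hc0.ne', hhom _ (inv_pos.2 hc0)]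
    rfl
  · have : 0 ≤ 1 - p₀ / 2 := by linarith
    positivity

end Block

/-! ### Exponential decay along the chain -/

section Chain

variable {W : ℕ} {lam : ℝ}

/-- A block of the resolvent as a function of the sequence of sites, where the self-energy `B` is
subtracted from the first diagonal block. -/
noncomputable def chainBlock (n : ℕ) (lam : ℝ) (i j : Fin n) (B : Mat W)
    (x : ℕ → Mat W × Mat W) : Mat W :=
  resolventBlock n (subHead B fun k => (x k).1) (fun k => (x k).2) lam i j

theorem chainBlock_succ_succ {n : ℕ} (i j : Fin n) {B : Mat W} {y : Mat W × Mat W}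
    (hu : IsUnit (y.1 - B - (lam : ℂ) • (1 : Mat W))) (x : ℕ → Mat W × Mat W) :
    chainBlock (n + 1) lam i.succ j.succ B (seqCons y x) =
      chainBlock n lam i j (nextEnergy lam B y) x :=
  resolventBlock_succ_succ (V := subHead B fun k => (seqCons y x k).1)
    (T := fun k => (seqCons y x k).2) hu i j

theorem chainBlock_zero_succ {n : ℕ} (j : Fin (n + 1)) {B : Mat W} {y : Mat W × Mat W}
    (hu : IsUnit (y.1 - B - (lam : ℂ) • (1 : Mat W))) (x : ℕ → Mat W × Mat W) :
    chainBlock (n + 2) lam 0 j.succ B (seqCons y x) =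
      hop lam B y * chainBlock (n + 1) lam 0 j (nextEnergy lam B y) x := by
  rw [hop, neg_mul]
  exact resolventBlock_zero_succ (V := subHead B fun k => (seqCons y x k).1)
    (T := fun k => (seqCons y x k).2) hu j

theorem _root_.Measurable.chainBlock {X : Type*} [MeasurableSpace X] {n : ℕ} (i j : Fin n)
    {B : X → Mat W} {x : X → ℕ → Mat W × Mat W} (hB : Measurable B) (hx : Measurable x) :
    Measurable fun z => BandMatrix.chainBlock n lam i j (B z) (x z) := by
  have hV : ∀ k, Measurable fun z => subHead (B z) (fun k => (x z k).1) k := by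
    intro k
    unfold subHead
    split_ifs
    · exact ((measurable_pi_apply 0).comp hx).fst.matrix_sub hB
    · exact ((measurable_pi_apply k).comp hx).fst
  have hT : ∀ k, Measurable fun z => (x z k).2 := fun k => ((measurable_pi_apply k).comp hx).snd
  have hX : Measurable fun z => bandMatrix n (subHead (B z) fun k => (x z k).1)
      (fun k => (x z k).2) := by
    refine measurable_matrix fun p q => ?_
    simp only [bandMatrix, Matrix.of_apply]
    split_ifs
    · exact measurable_entry (hV _) _ _
    · exact measurable_entry (hT _) _ _
    · exact measurable_entry (hT _).matrix_conjTranspose _ _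
    · exact measurable_const
  exact measurable_matrix fun a b =>
    measurable_entry (hX.matrix_sub measurable_const).matrix_inv (i, a) (j, b)

theorem lintegral_seqCons_three {Y : Type*} [MeasurableSpace Y] (π : Measure Y)
    [IsProbabilityMeasure π] {F : (ℕ → Y) → ℝ≥0∞} (hF : Measurable F) :
    ∫⁻ x, F x ∂(Measure.infinitePi fun _ : ℕ => π) =
      ∫⁻ p, ∫⁻ x, F (seqCons p.1 (seqCons p.2.1 (seqCons p.2.2 x)))
        ∂(Measure.infinitePi fun _ : ℕ => π) ∂(π.prod (π.prod π)) := by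
  have h1 : ∀ y, Measurable fun x => F (seqCons y x) := fun y =>
    hF.comp (measurable_seqCons.comp measurable_prodMk_left)
  have h2 : Measurable fun z : (Y × Y × Y) × (ℕ → Y) =>
      F (seqCons z.1.1 (seqCons z.1.2.1 (seqCons z.1.2.2 z.2))) :=
    hF.comp (measurable_seqCons.comp (measurable_fst.fst.prodMk
      (measurable_seqCons.comp (measurable_fst.snd.fst.prodMk
        (measurable_seqCons.comp (measurable_fst.snd.snd.prodMk measurable_snd))))))
  have h3 := h2.lintegral_prod_right' (ν := Measure.infinitePi fun _ : ℕ => π)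
  rw [lintegral_seqCons π hF, lintegral_prod _ h3.aemeasurable]
  refine lintegral_congr fun y => ?_
  have h4 : Measurable fun q : Y × Y =>
      ∫⁻ x, F (seqCons y (seqCons q.1 (seqCons q.2 x))) ∂(Measure.infinitePi fun _ : ℕ => π) :=
    h3.comp measurable_prodMk_left
  rw [lintegral_seqCons π (h1 y), lintegral_prod _ h4.aemeasurable]
  refine lintegral_congr fun y' => ?_
  exact lintegral_seqCons π (F := fun x => F (seqCons y (seqCons y' x)))
    ((h1 y).comp (measurable_seqCons.comp measurable_prodMk_left))

variable {A : NonUnitalStarSubalgebra ℝ (Mat W)} {P Q : Measure (Mat W)}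
  {M N τ ε δ p₀ q₀ : ℝ} {E : Set (Mat W)}

/-- The Wegner estimate makes the pivot invertible almost surely for each fixed hermitian energy;
the outgoing energy is hermitian again, so the statement can be iterated. -/
theorem RegularSite.ae_site (h : RegularSite A P Q lam M N τ ε δ p₀ q₀ E) {B : Mat W}
    (hB : B ∈ herm A) : ∀ᵐ y ∂(P.prod Q), IsUnit (y.1 - B - (lam : ℂ) • (1 : Mat W)) ∧
      nextEnergy lam B y ∈ herm A := by
  have h1 := Measure.quasiMeasurePreserving_fst (μ := P) (ν := Q) |>.ae h.ae_herm
  have h2 := Measure.quasiMeasurePreserving_snd (μ := P) (ν := Q) |>.ae h.ae_conjSet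
  have h3 := Measure.quasiMeasurePreserving_fst (μ := P) (ν := Q) |>.ae
    (h.ae_isUnit _ ((herm A).add_mem hB h.lam_mem))
  filter_upwards [h1, h2, h3] with y hy1 hy2 hy3
  rw [sub_sub]
  exact ⟨hy3, nextEnergy_mem h.lam_mem hB hy1 hy2⟩

variable [IsProbabilityMeasure P] [IsProbabilityMeasure Q]

/-- The exceptional null set of a site depends on the energy it receives, so the comparison is made
one integral at a time. -/
theorem RegularSite.lintegral_three_mono (h : RegularSite A P Q lam M N τ ε δ p₀ q₀ E) {B : Mat W}
    (hB : B ∈ herm A) {K₁ K₂ : (Mat W × Mat W) × (Mat W × Mat W) × (Mat W × Mat W) → ℝ≥0∞}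
    (hK₁ : Measurable K₁) (hK₂ : Measurable K₂)
    (hK : ∀ p, IsUnit (p.1.1 - B - (lam : ℂ) • (1 : Mat W)) →
      IsUnit (p.2.1.1 - nextEnergy lam B p.1 - (lam : ℂ) • (1 : Mat W)) →
      IsUnit (p.2.2.1 - nextEnergy lam (nextEnergy lam B p.1) p.2.1 - (lam : ℂ) • (1 : Mat W)) →
      (threeSites lam B p).2 ∈ herm A → K₁ p ≤ K₂ p) :
    ∫⁻ p, K₁ p ∂((P.prod Q).prod ((P.prod Q).prod (P.prod Q))) ≤
      ∫⁻ p, K₂ p ∂((P.prod Q).prod ((P.prod Q).prod (P.prod Q))) := by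
  rw [lintegral_prod _ hK₁.aemeasurable, lintegral_prod _ hK₂.aemeasurable]
  refine lintegral_mono_ae ?_
  filter_upwards [h.ae_site hB] with y₀ hy₀
  have hK₁' : Measurable fun z => K₁ (y₀, z) := hK₁.comp measurable_prodMk_left
  have hK₂' : Measurable fun z => K₂ (y₀, z) := hK₂.comp measurable_prodMk_left
  rw [lintegral_prod _ hK₁'.aemeasurable, lintegral_prod _ hK₂'.aemeasurable]
  refine lintegral_mono_ae ?_
  filter_upwards [h.ae_site hy₀.2] with y₁ hy₁
  refine lintegral_mono_ae ?_
  filter_upwards [h.ae_site hy₁.2] with y₂ hy₂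
  exact hK (y₀, y₁, y₂) hy₀.1 hy₁.1 hy₂.1 hy₂.2

theorem chainBlock_three {k : ℕ} (j : Fin (k + 1)) {B : Mat W}
    (p : (Mat W × Mat W) × (Mat W × Mat W) × (Mat W × Mat W))
    (h₀ : IsUnit (p.1.1 - B - (lam : ℂ) • (1 : Mat W)))
    (h₁ : IsUnit (p.2.1.1 - nextEnergy lam B p.1 - (lam : ℂ) • (1 : Mat W)))
    (h₂ : IsUnit (p.2.2.1 - nextEnergy lam (nextEnergy lam B p.1) p.2.1 -
      (lam : ℂ) • (1 : Mat W))) (x : ℕ → Mat W × Mat W) :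
    chainBlock (k + 4) lam 0 j.succ.succ.succ B
        (seqCons p.1 (seqCons p.2.1 (seqCons p.2.2 x))) =
      (threeSites lam B p).1 * chainBlock (k + 1) lam 0 j (threeSites lam B p).2 x := by
  rw [chainBlock_zero_succ (n := k + 2) j.succ.succ h₀,
    chainBlock_zero_succ (n := k + 1) j.succ h₁, chainBlock_zero_succ j h₂]
  simp only [threeSites, Matrix.mul_assoc]

/-- If three sites gain a factor `θ`, then `3 m` sites gain the factor `θ ^ m`. -/
theorem RegularSite.chain_decay_zero (h : RegularSite A P Q lam M N τ ε δ p₀ q₀ E) {r s : ℝ}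
    (hr : 0 < r) (hrs : r < s) {θ : ℝ≥0∞}
    (hθ : ∀ B ∈ herm A, ∀ F : Mat W × Mat W → ℝ≥0∞, Measurable F →
      (∀ a : ℝ, 0 < a → ∀ Y B', F (a • Y, B') = ENNReal.ofReal a * F (Y, B')) →
      ∫⁻ x, F (threeSites lam B x) ^ r ∂((P.prod Q).prod ((P.prod Q).prod (P.prod Q))) ≤
        θ * (∫⁻ x, F (threeSites lam B x) ^ s
          ∂((P.prod Q).prod ((P.prod Q).prod (P.prod Q)))) ^ (r / s)) (m : ℕ) :
    ∀ (k : ℕ) (j : Fin (k + 1)), 3 * m ≤ (j : ℕ) → ∀ B ∈ herm A, ∀ Φ : Mat W → ℝ≥0∞,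
      Measurable Φ → (∀ a : ℝ, 0 < a → ∀ Y, Φ (a • Y) = ENNReal.ofReal a * Φ Y) →
      ∫⁻ x, Φ (chainBlock (k + 1) lam 0 j B x) ^ r
          ∂(Measure.infinitePi fun _ : ℕ => P.prod Q) ≤
        θ ^ m * (∫⁻ x, Φ (chainBlock (k + 1) lam 0 j B x) ^ s
          ∂(Measure.infinitePi fun _ : ℕ => P.prod Q)) ^ (r / s) := by
  have hs : 0 < s := hr.trans hrs
  induction m with
  | zero =>
    intro k j _ B _ Φ hΦ _
    rw [pow_zero, one_mul]
    exact lintegral_rpow_le_rpow_lintegral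
      (hΦ.comp (Measurable.chainBlock _ _ measurable_const measurable_id)) hr hrs.le
  | succ m ih =>
    intro k j hj B hB Φ hΦ hhom
    obtain ⟨k, rfl⟩ : ∃ k', k = k' + 3 := ⟨k - 3, by have := j.2; omega⟩
    obtain ⟨j, rfl⟩ := Fin.exists_succ_eq.2 (show j ≠ 0 by rintro rfl; simp at hj)
    obtain ⟨j, rfl⟩ := Fin.exists_succ_eq.2 (show j ≠ 0 by
      rintro rfl; simp only [Fin.val_succ, Fin.val_zero] at hj; omega)
    obtain ⟨j, rfl⟩ := Fin.exists_succ_eq.2 (show j ≠ 0 by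
      rintro rfl; simp only [Fin.val_succ, Fin.val_zero] at hj; omega)
    have hjm : 3 * m ≤ (j : ℕ) := by simp at hj; omega
    set πs := Measure.infinitePi fun _ : ℕ => P.prod Q
    set π3 := (P.prod Q).prod ((P.prod Q).prod (P.prod Q))
    have hG : ∀ q : ℝ, Measurable fun x =>
        Φ (chainBlock (k + 3 + 1) lam 0 j.succ.succ.succ B x) ^ q := fun q =>
      (hΦ.comp (Measurable.chainBlock _ _ measurable_const measurable_id)).pow_const q
    have hK : ∀ q : ℝ, Measurable fun p : (Mat W × Mat W) × (Mat W × Mat W) × (Mat W × Mat W) =>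
        ∫⁻ x, Φ (chainBlock (k + 3 + 1) lam 0 j.succ.succ.succ B
          (seqCons p.1 (seqCons p.2.1 (seqCons p.2.2 x)))) ^ q ∂πs := fun q =>
      ((hG q).comp (measurable_seqCons.comp (measurable_fst.fst.prodMk
        (measurable_seqCons.comp (measurable_fst.snd.fst.prodMk
          (measurable_seqCons.comp (measurable_fst.snd.snd.prodMk
            measurable_snd))))))).lintegral_prod_right'
    -- Given the hop product and the outgoing energy of the first three sites, this is the s-th
    -- moment over the rest. Its root of order s is homogeneous of degree one in the hop product,
    -- hence an admissible observable for the three-site estimate.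
    let I : Mat W × Mat W → ℝ≥0∞ := fun z =>
      ∫⁻ x, Φ (z.1 * chainBlock (k + 1) lam 0 j z.2 x) ^ s ∂πs
    have hI : Measurable I :=
      ((hΦ.comp (measurable_fst.fst.matrix_mul
        (Measurable.chainBlock _ _ measurable_fst.snd measurable_snd))).pow_const
          s).lintegral_prod_right'
    let F : Mat W × Mat W → ℝ≥0∞ := fun z => I z ^ (1 / s)
    have hF : Measurable F := hI.pow_const _
    have hFr : ∀ z, F z ^ r = I z ^ (r / s) := fun z => by
      simp only [F]
      rw [← ENNReal.rpow_mul, one_div_mul_eq_div]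
    have hFs : ∀ z, F z ^ s = I z := fun z => by
      simp only [F]
      rw [← ENNReal.rpow_mul, one_div_mul_cancel hs.ne', ENNReal.rpow_one]
    have hFhom : ∀ a : ℝ, 0 < a → ∀ Y B', F (a • Y, B') = ENNReal.ofReal a * F (Y, B') := by
      intro a ha Y B'
      have : I (a • Y, B') = ENNReal.ofReal a ^ s * I (Y, B') := by
        simp only [I]
        rw [← lintegral_const_mul]
        · refine lintegral_congr fun x => ?_
          rw [smul_mul_assoc, hhom a ha, ENNReal.mul_rpow_of_nonneg _ _ hs.le]
        · exact (hΦ.comp (measurable_const.matrix_mul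
            (Measurable.chainBlock _ _ measurable_const measurable_id))).pow_const s
      simp only [F]
      rw [this, ENNReal.mul_rpow_of_nonneg _ _ (by positivity), ← ENNReal.rpow_mul,
        mul_one_div_cancel hs.ne', ENNReal.rpow_one]
    rw [lintegral_seqCons_three _ (hG r), lintegral_seqCons_three _ (hG s)]
    calc ∫⁻ p, ∫⁻ x, Φ (chainBlock (k + 3 + 1) lam 0 j.succ.succ.succ B
          (seqCons p.1 (seqCons p.2.1 (seqCons p.2.2 x)))) ^ r ∂πs ∂π3
        ≤ ∫⁻ p, θ ^ m * F (threeSites lam B p) ^ r ∂π3 := by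
          refine h.lintegral_three_mono hB (hK r)
            (measurable_const.mul ((hF.comp (measurable_threeSites B)).pow_const r)) ?_
          intro p h₀ h₁ h₂ h₃
          simp only [chainBlock_three j p h₀ h₁ h₂, hFr]
          -- The hop product is absorbed into the observable, which stays homogeneous; this is why
          -- the induction quantifies over Φ.
          refine ih k j hjm _ h₃ (fun Z => Φ ((threeSites lam B p).1 * Z))
            (hΦ.comp (measurable_const.matrix_mul measurable_id)) fun a ha Y => ?_
          rw [mul_smul_comm, hhom a ha]
      _ = θ ^ m * ∫⁻ p, F (threeSites lam B p) ^ r ∂π3 :=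
          lintegral_const_mul _ ((hF.comp (measurable_threeSites B)).pow_const r)
      _ ≤ θ ^ m * (θ * (∫⁻ p, F (threeSites lam B p) ^ s ∂π3) ^ (r / s)) := by
          gcongr
          exact hθ B hB F hF hFhom
      _ = θ ^ (m + 1) * (∫⁻ p, F (threeSites lam B p) ^ s ∂π3) ^ (r / s) := by
          rw [pow_succ, mul_assoc]
      _ ≤ _ := by
          refine mul_le_mul' le_rfl (ENNReal.rpow_le_rpow ?_ (by positivity))
          refine h.lintegral_three_mono hB ((hF.comp (measurable_threeSites B)).pow_const s)
            (hK s) ?_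
          intro p h₀ h₁ h₂ _
          simp only [chainBlock_three j p h₀ h₁ h₂, hFs, I]
          exact le_rfl

theorem RegularSite.chain_decay (h : RegularSite A P Q lam M N τ ε δ p₀ q₀ E) {r s : ℝ}
    (hr : 0 < r) (hrs : r < s) {θ : ℝ≥0∞}
    (hθ : ∀ B ∈ herm A, ∀ F : Mat W × Mat W → ℝ≥0∞, Measurable F →
      (∀ a : ℝ, 0 < a → ∀ Y B', F (a • Y, B') = ENNReal.ofReal a * F (Y, B')) →
      ∫⁻ x, F (threeSites lam B x) ^ r ∂((P.prod Q).prod ((P.prod Q).prod (P.prod Q))) ≤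
        θ * (∫⁻ x, F (threeSites lam B x) ^ s
          ∂((P.prod Q).prod ((P.prod Q).prod (P.prod Q)))) ^ (r / s)) (m : ℕ)
    {Φ : Mat W → ℝ≥0∞} (hΦ : Measurable Φ)
    (hhom : ∀ a : ℝ, 0 < a → ∀ Y, Φ (a • Y) = ENNReal.ofReal a * Φ Y) (i₀ : ℕ) :
    ∀ (n : ℕ) (i j : Fin n), (i : ℕ) = i₀ → (i : ℕ) + 3 * m ≤ (j : ℕ) → ∀ B ∈ herm A,
      ∫⁻ x, Φ (chainBlock n lam i j B x) ^ r ∂(Measure.infinitePi fun _ : ℕ => P.prod Q) ≤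
        θ ^ m * (∫⁻ x, Φ (chainBlock n lam i j B x) ^ s
          ∂(Measure.infinitePi fun _ : ℕ => P.prod Q)) ^ (r / s) := by
  have hs : 0 < s := hr.trans hrs
  induction i₀ with
  | zero =>
    intro n i j hi hj B hB
    obtain ⟨k, rfl⟩ : ∃ k, n = k + 1 := ⟨n - 1, by have := j.2; omega⟩
    obtain rfl : i = 0 := Fin.ext hi
    exact h.chain_decay_zero hr hrs hθ m k j (by simpa using hj) B hB Φ hΦ hhom
  | succ i₀ ih =>
    intro n i j hi hj B hB
    obtain ⟨k, rfl⟩ : ∃ k, n = k + 1 := ⟨n - 1, by have := j.2; omega⟩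
    obtain ⟨i, rfl⟩ := Fin.exists_succ_eq.2 (show i ≠ 0 by rintro rfl; simp at hi)
    obtain ⟨j, rfl⟩ := Fin.exists_succ_eq.2 (show j ≠ 0 by rintro rfl; simp at hj)
    simp only [Fin.val_succ] at hi hj
    set πs := Measure.infinitePi fun _ : ℕ => P.prod Q
    have hG : ∀ q : ℝ, Measurable fun x => Φ (chainBlock (k + 1) lam i.succ j.succ B x) ^ q :=
      fun q => (hΦ.comp (Measurable.chainBlock _ _ measurable_const measurable_id)).pow_const q
    let I : Mat W × Mat W → ℝ≥0∞ := fun y =>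
      ∫⁻ x, Φ (chainBlock k lam i j (nextEnergy lam B y) x) ^ s ∂πs
    have hI : Measurable I :=
      ((hΦ.comp (Measurable.chainBlock _ _ (Measurable.nextEnergy lam measurable_const
        measurable_fst) measurable_snd)).pow_const s).lintegral_prod_right'
    rw [lintegral_seqCons _ (hG r), lintegral_seqCons _ (hG s)]
    calc ∫⁻ y, ∫⁻ x, Φ (chainBlock (k + 1) lam i.succ j.succ B (seqCons y x)) ^ r ∂πs ∂(P.prod Q)
        ≤ ∫⁻ y, θ ^ m * I y ^ (r / s) ∂(P.prod Q) := by
          refine lintegral_mono_ae ?_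
          filter_upwards [h.ae_site hB] with y hy
          simp only [chainBlock_succ_succ i j hy.1]
          exact ih k i j (by omega) (by omega) _ hy.2
      _ = θ ^ m * ∫⁻ y, I y ^ (r / s) ∂(P.prod Q) := lintegral_const_mul _ (hI.pow_const _)
      -- Averaging over a site before the row index only needs Jensen for the exponent r/s ≤ 1.
      _ ≤ θ ^ m * (∫⁻ y, I y ∂(P.prod Q)) ^ (r / s) := by
          gcongr
          have := lintegral_rpow_le_rpow_lintegral (μ := P.prod Q) hI (div_pos hr hs)
            ((div_le_one hs).2 hrs.le)
          simpa only [ENNReal.rpow_one, div_one] using this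
      _ = _ := by
          congr 2
          refine lintegral_congr_ae ?_
          filter_upwards [h.ae_site hB] with y hy
          simp only [chainBlock_succ_succ i j hy.1, I]
          rfl

end Chain

/-! ### From the assumptions to decay -/

section Assumptions

variable {S : Set ℕ} {A : ∀ W : ℕ, NonUnitalStarSubalgebra ℝ (Mat W)}
  {P Q : ∀ W : ℕ, Measure (Mat W)} {ρ : ∀ W : ℕ, Mat W → ℝ}
  {κ σ p₀ δ ε L a ζ q₀ τ b : ℝ}

/-- Singular matrices lie in every event of the Wegner estimate; let t tend to infinity. -/
theorem DiagonalAssumption.ae_isUnit (hP : DiagonalAssumption S A P ρ κ σ p₀ δ ε L a ζ) {W : ℕ}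
    (hW : W ∈ S) {B : Mat W} (hB : B ∈ herm (A W)) : ∀ᵐ V ∂(P W), IsUnit (V - B) := by
  have h1 : ∀ t : ℝ, 0 < t → P W {V | ¬ IsUnit (V - B)} ≤ ENNReal.ofReal (κ * (1 / t)) := by
    intro t ht
    refine (measure_mono fun V hV => ?_).trans (hP.wegner_one W hW B hB t ht)
    simp only [Set.mem_ofPred_eq] at hV ⊢
    rw [invNorm, if_neg hV]
    exact ENNReal.ofReal_lt_top
  have h2 : Filter.Tendsto (fun t : ℝ => ENNReal.ofReal (κ * (1 / t))) Filter.atTop (nhds 0) := by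
    rw [← ENNReal.ofReal_zero]
    refine ENNReal.tendsto_ofReal ?_
    have := (tendsto_inv_atTop_zero (𝕜 := ℝ)).const_mul κ
    simpa using this
  rw [ae_iff]
  refine le_antisymm (ge_of_tendsto h2 ?_) bot_le
  filter_upwards [Filter.eventually_gt_atTop 0] with t ht using h1 t ht

theorem DiagonalAssumption.ae_herm (hP : DiagonalAssumption S A P ρ κ σ p₀ δ ε L a ζ) {W : ℕ}
    (hW : W ∈ S) : ∀ᵐ V ∂(P W), V ∈ herm (A W) := by
  rw [hP.absolutelyContinuous W hW]
  exact (withDensity_absolutelyContinuous _ _).ae_le ae_mem_herm_hermVolume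

theorem DiagonalAssumption.exists_regularSite (hP : DiagonalAssumption S A P ρ κ σ p₀ δ ε L a ζ)
    (hQ : OffDiagonalAssumption S A Q q₀ τ b) {W : ℕ} (hW : W ∈ S) (lam : ℝ) :
    ∃ E, RegularSite (A W) (P W) (Q W) lam (2 * κ / p₀ * (W : ℝ) ^ (1 + σ)) (L * (W : ℝ) ^ a)
      (τ * (W : ℝ) ^ b) (ε * (W : ℝ) ^ (-ζ)) δ p₀ q₀ E := by
  obtain ⟨E, hE, hEherm, hEp, hEreg⟩ := hP.fluctuation_regular W hW
  have := hP.isProbabilityMeasure W hW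
  have hκ := hP.kappa_pos
  have hp := hP.p₀_pos
  have hε := hP.epsilon_pos
  have hW0 : (0 : ℝ) ≤ W := Nat.cast_nonneg W
  -- Almost every V is an invertible element of the algebra; one of them yields the identity.
  obtain ⟨V₀, hV₀, hV₀u⟩ := ((hP.ae_herm hW).and (hP.ae_isUnit hW (zero_mem (herm (A W))))).exists
  refine ⟨E, {
    ae_herm := hP.ae_herm hW
    ae_conjSet := hQ.supported W hW
    ae_isUnit := fun B hB => hP.ae_isUnit hW hB
    lam_mem := smul_one_mem_herm hV₀ (by rwa [sub_zero] at hV₀u) lam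
    M_nonneg := by positivity
    p₀_pos := hp
    q₀_pos := hQ.q₀_pos
    δ_pos := hP.delta_pos
    inv_bound := fun B hB => ?_
    off_bound := hQ.norm_bound W hW
    measurableSet := hE
    subset := hEherm
    prob_le := hEp
    diag_bound := fun V hV => (hEreg V hV).1
    affine := ?_ }⟩
  -- The value t = 2κ/p₀ makes the Wegner probability p₀/2.
  · have := hP.wegner_one W hW B hB (2 * κ / p₀) (by positivity)
    rwa [show κ * (1 / (2 * κ / p₀)) = p₀ / 2 by field_simp] at this
  · intro U hUE hU c hc D hD hUD g hg
    rw [hP.absolutelyContinuous W hW]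
    refine setLIntegral_affine_le (hP.measurable_density W hW) hP.delta_pos hU hc hD ?_ hg
    intro V hV
    refine (hEreg V (hUE hV)).2 _ ((herm (A W)).add_mem ((herm (A W)).smul_mem c
      (hEherm (hUE hV))) hD) V (hEherm (hUE hV)) (hUD V hV) ?_
    rw [sub_self]
    have : opNorm (0 : Mat W) = 0 := by simp [opNorm]
    rw [this]
    positivity

/-- The gain at three sites is of order `h ^ 2` when the pivot is scaled by `1 + h`. -/
theorem one_sub_scaling_gain_le {h s β : ℝ} (h₀ : 0 ≤ h) (h₁ : h ≤ 1) (hs₀ : 0 < s) (hs₁ : s < 1)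
    (hβ : 0 ≤ β) :
    1 - β * (1 - (1 + h)⁻¹ ^ (s / 2)) ^ 2 ≤ Real.exp (-(β * (s ^ 2 / 16) * h ^ 2)) := by
  have h2 : (1 + h)⁻¹ ≤ 1 + -(h / 2) := by
    rw [inv_le_iff_one_le_mul₀ (by linarith)]
    nlinarith
  -- Bernoulli's inequality for the concave power s/2 ≤ 1.
  have h3 : (1 + h)⁻¹ ^ (s / 2) ≤ 1 + s / 2 * (-(h / 2)) :=
    (Real.rpow_le_rpow (inv_nonneg.2 (by linarith)) h2 (by linarith)).trans
      (rpow_one_add_le_one_add_mul_self (by linarith) (by linarith) (by linarith))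
  have h4 : s * h / 4 ≤ 1 - (1 + h)⁻¹ ^ (s / 2) := by linarith
  have h5 : (s * h / 4) ^ 2 ≤ (1 - (1 + h)⁻¹ ^ (s / 2)) ^ 2 :=
    pow_le_pow_left₀ (by positivity) h4 2
  calc 1 - β * (1 - (1 + h)⁻¹ ^ (s / 2)) ^ 2 ≤ 1 - β * (s * h / 4) ^ 2 := by gcongr
    _ = -(β * (s ^ 2 / 16) * h ^ 2) + 1 := by ring
    _ ≤ _ := Real.add_one_le_exp _

/-- This is where the condition on ν comes from: the pivot is of order at most W^m with m = max(a, 1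
+ σ + 2b), the second exponent coming from the self-energy, and a dilation by 1 + O(W^(-ν)) must
move it by at most εW^(-ζ). -/
theorem scale_bound {L a κ' b τ σ Λ lam ε ζ ν : ℝ} (hL : 0 ≤ L) (ha : 0 ≤ a) (hκ : 0 ≤ κ')
    (hε : 0 < ε) (hν : ζ + max a (1 + σ + 2 * b) ≤ ν) (hlam : |lam| ≤ Λ) {w : ℝ} (hw : 1 ≤ w) :
    min 1 (ε / (L + τ ^ 2 * κ' + Λ + 1)) * w ^ (-ν) *
      (L * w ^ a + (τ * w ^ b) ^ 2 * (κ' * w ^ (1 + σ)) + |lam|) ≤ ε * w ^ (-ζ) := by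
  have hw0 : 0 < w := by linarith
  have hΛ : 0 ≤ Λ := (abs_nonneg _).trans hlam
  set m := max a (1 + σ + 2 * b)
  have hK : 0 < L + τ ^ 2 * κ' + Λ + 1 := by positivity
  have h1 : w ^ a ≤ w ^ m := Real.rpow_le_rpow_of_exponent_le hw (le_max_left _ _)
  have h2 : w ^ (1 + σ + 2 * b) ≤ w ^ m := Real.rpow_le_rpow_of_exponent_le hw (le_max_right _ _)
  have h3 : 1 ≤ w ^ m := Real.one_le_rpow hw (ha.trans (le_max_left _ _))
  have h4 : (τ * w ^ b) ^ 2 * (κ' * w ^ (1 + σ)) = τ ^ 2 * κ' * w ^ (1 + σ + 2 * b) := by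
    rw [Real.rpow_add hw0 (1 + σ), two_mul, Real.rpow_add hw0 b]
    ring
  have h5 : L * w ^ a + (τ * w ^ b) ^ 2 * (κ' * w ^ (1 + σ)) + |lam| ≤
      (L + τ ^ 2 * κ' + Λ + 1) * w ^ m := by
    rw [h4]
    have e1 := mul_le_mul_of_nonneg_left h1 hL
    have e2 := mul_le_mul_of_nonneg_left h2 (show 0 ≤ τ ^ 2 * κ' by positivity)
    have e3 := mul_le_mul_of_nonneg_left h3 hΛ
    linarith
  have h6 : w ^ (-ν) * w ^ m ≤ w ^ (-ζ) := by
    rw [← Real.rpow_add hw0]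
    exact Real.rpow_le_rpow_of_exponent_le hw (by linarith)
  have h7 : 0 ≤ w ^ (-ν) := Real.rpow_nonneg hw0.le _
  calc _ ≤ ε / (L + τ ^ 2 * κ' + Λ + 1) * w ^ (-ν) * ((L + τ ^ 2 * κ' + Λ + 1) * w ^ m) := by
        gcongr
        exact min_le_right _ _
    _ = ε * (w ^ (-ν) * w ^ m) := by field_simp
    _ ≤ ε * w ^ (-ζ) := by gcongr

/-- Exponential decay of the moments of the resolvent blocks above the diagonal. -/
theorem DiagonalAssumption.exists_decay (hP : DiagonalAssumption S A P ρ κ σ p₀ δ ε L a ζ)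
    (hQ : OffDiagonalAssumption S A Q q₀ τ b) (hS : ∀ W ∈ S, 0 < W) {ν r s Λ : ℝ} (hν₀ : 0 < ν)
    (hν : ζ + max a (1 + σ + 2 * b) ≤ ν) (hr : 0 < r) (hrs : r < s) (hs : s < 1) (hΛ : 0 < Λ) :
    ∃ C : ℝ, 0 < C ∧ ∀ W ∈ S, ∀ (n : ℕ) (i j : Fin n), (i : ℕ) + 3 ≤ j →
      ∀ lam ∈ Set.Icc (-Λ) Λ, ∀ Φ : Mat W → ℝ≥0∞, Measurable Φ →
      (∀ c : ℝ, 0 < c → ∀ Y, Φ (c • Y) = ENNReal.ofReal c * Φ Y) →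
      ∫⁻ x, Φ (chainBlock n lam i j 0 x) ^ r
          ∂(Measure.infinitePi fun _ : ℕ => (P W).prod (Q W)) ≤
        ENNReal.ofReal (Real.exp (-C * (W : ℝ) ^ (-2 * ν) * ((j : ℝ) - i))) *
          (∫⁻ x, Φ (chainBlock n lam i j 0 x) ^ s
            ∂(Measure.infinitePi fun _ : ℕ => (P W).prod (Q W))) ^ (r / s) := by
  -- A member of S is used to deduce p₀ ≤ 1, without which the constant could fail to be positive.
  rcases S.eq_empty_or_nonempty with rfl | ⟨W₀, hW₀⟩
  · exact ⟨1, one_pos, fun W hW => absurd hW (Set.notMem_empty W)⟩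
  have hp := hP.p₀_pos
  have hq := hQ.q₀_pos
  have hε := hP.epsilon_pos
  have hδ := hP.delta_pos
  have hκ := hP.kappa_pos
  have hL := hP.L_nonneg
  have hs0 : 0 < s := hr.trans hrs
  have hp1 : p₀ ≤ 1 := by
    obtain ⟨E, -, -, hE, -⟩ := hP.fluctuation_regular W₀ hW₀
    have := hP.isProbabilityMeasure W₀ hW₀
    exact ENNReal.ofReal_le_one.1 (hE.trans prob_le_one)
  have hα₀ : 0 < r / s := div_pos hr hs0
  have hα₁ : 0 < 1 - r / s := by rw [sub_pos, div_lt_one hs0]; exact hrs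
  have hp2 : 0 < 1 - p₀ / 2 := by linarith
  set β := r / s * (1 - r / s) * ((1 - p₀ / 2) * q₀ * ((p₀ / 2) * q₀ * p₀)) /
    (2 * (1 + δ⁻¹ * δ⁻¹)) with hβ
  have hβ0 : 0 < β := by positivity
  set c₀ := min 1 (ε / (L + τ ^ 2 * (2 * κ / p₀) + Λ + 1)) with hc₀
  have hc₀pos : 0 < c₀ := lt_min one_pos (by positivity)
  have hc₀1 : c₀ ≤ 1 := min_le_left _ _
  -- Each triple gains the exponent β(s²/16)c₀²W^(-2ν), and a distance d ≥ 3 contains at least d/5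
  -- disjoint triples.
  refine ⟨β * (s ^ 2 / 16) * c₀ ^ 2 / 5, by positivity, ?_⟩
  intro W hW n i j hij lam hlam Φ hΦ hhom
  have := hP.isProbabilityMeasure W hW
  have := hQ.isProbabilityMeasure W hW
  obtain ⟨E, hE⟩ := hP.exists_regularSite hQ hW lam
  have hw : (1 : ℝ) ≤ W := by exact_mod_cast hS W hW
  have hw0 : (0 : ℝ) < W := by linarith
  set h := c₀ * (W : ℝ) ^ (-ν) with hh
  have hwν : 0 < (W : ℝ) ^ (-ν) := Real.rpow_pos_of_pos hw0 _
  have hwν1 : (W : ℝ) ^ (-ν) ≤ 1 := Real.rpow_le_one_of_one_le_of_nonpos hw (by linarith)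
  have hh0 : 0 ≤ h := by positivity
  have hh1 : h ≤ 1 := mul_le_one₀ hc₀1 hwν.le hwν1
  have hscale : (1 + h - 1) * (L * (W : ℝ) ^ a + (τ * (W : ℝ) ^ b) ^ 2 *
      (2 * κ / p₀ * (W : ℝ) ^ (1 + σ)) + |lam|) ≤ ε * (W : ℝ) ^ (-ζ) := by
    rw [add_sub_cancel_left]
    exact scale_bound hL hP.a_nonneg (by positivity) hε hν (abs_le.2 hlam) hw
  set m := ((j : ℕ) - i) / 3 with hm
  have hdecay := hE.chain_decay hr hrs (fun B hB F hF hFhom =>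
    hE.threeSites_moment (by linarith) hscale hr hrs hB hF hFhom) m hΦ hhom i n i j rfl
    (by omega) 0 (zero_mem _)
  refine hdecay.trans ?_
  gcongr
  have hθ := one_sub_scaling_gain_le hh0 hh1 hs0 hs hβ0.le
  have heq : r / s * (1 - r / s) * ((1 - (1 + h)⁻¹ ^ (s / 2)) ^ 2 *
      ((1 - p₀ / 2) * q₀ * ((p₀ / 2) * q₀ * p₀)) / (2 * (1 + δ⁻¹ * δ⁻¹))) =
      β * (1 - (1 + h)⁻¹ ^ (s / 2)) ^ 2 := by
    rw [hβ]
    ring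
  rw [heq]
  refine (pow_le_pow_left' (ENNReal.ofReal_le_ofReal hθ) m).trans ?_
  rw [← ENNReal.ofReal_pow (Real.exp_nonneg _), ← Real.exp_nat_mul]
  refine ENNReal.ofReal_le_ofReal (Real.exp_le_exp.2 ?_)
  have hsq : h ^ 2 = c₀ ^ 2 * (W : ℝ) ^ (-2 * ν) := by
    rw [hh, mul_pow, ← Real.rpow_natCast ((W : ℝ) ^ (-ν)), ← Real.rpow_mul hw0.le]
    congr 2
    push_cast
    ring
  have hmj : ((j : ℝ) - i) / 5 ≤ m := by
    have h5 : (j : ℕ) ≤ i + 5 * m := by omega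
    have h6 : ((j : ℕ) : ℝ) ≤ (i : ℕ) + 5 * m := by exact_mod_cast h5
    linarith
  have hK : 0 ≤ β * (s ^ 2 / 16) * c₀ ^ 2 * (W : ℝ) ^ (-2 * ν) := by positivity
  rw [hsq]
  nlinarith [mul_le_mul_of_nonneg_left hmj hK]

end Assumptions

/-! ### Observables defined on the generated algebra -/

section Observables

variable {W : ℕ} (A : NonUnitalStarSubalgebra ℝ (Mat W))

open Classical in
/-- Extension by zero of a nonnegative function on the generated algebra. -/
noncomputable def extendZero (Φ : Mat W → ℝ) (Y : Mat W) : ℝ≥0∞ :=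
  if Y ∈ genAlg A then ENNReal.ofReal (Φ Y) else 0

variable {A}

/-- The generated algebra is a finite-dimensional subspace, hence closed and Borel. -/
theorem measurable_extendZero {Φ : Mat W → ℝ}
    (hΦ : Measurable fun Y : genAlg A => Φ (Y : Mat W)) : Measurable (extendZero A Φ) := by
  refine measurable_of_restrict_of_restrict_compl (s := (genAlg A : Set (Mat W)))
    (isClosed_coe (genAlg A)).measurableSet ?_ ?_
  · have : (genAlg A : Set (Mat W)).domRestrict (extendZero A Φ) =
        fun Y : genAlg A => ENNReal.ofReal (Φ (Y : Mat W)) := by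
      ext1 Y
      exact if_pos Y.2
    rw [this]
    exact hΦ.ennreal_ofReal
  · have : (genAlg A : Set (Mat W))ᶜ.domRestrict (extendZero A Φ) = fun _ => 0 := by
      ext1 Y
      exact if_neg Y.2
    rw [this]
    exact measurable_const

theorem extendZero_smul {Φ : Mat W → ℝ}
    (hhom : ∀ Y ∈ genAlg A, ∀ α : ℝ, 0 ≤ α → Φ (α • Y) = α * Φ Y) {c : ℝ} (hc : 0 < c) (Y : Mat W) :
    extendZero A Φ (c • Y) = ENNReal.ofReal c * extendZero A Φ Y := by
  unfold extendZero
  by_cases hY : Y ∈ genAlg A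
  · have hcY : c • Y ∈ genAlg A := SMulMemClass.smul_mem c hY
    rw [if_pos hY, if_pos hcY, hhom Y hY c hc.le, ENNReal.ofReal_mul hc.le]
  · have hcY : c • Y ∉ genAlg A := fun h => hY (by
      have h2 : c⁻¹ • (c • Y) ∈ genAlg A := SMulMemClass.smul_mem c⁻¹ h
      rwa [inv_smul_smul₀ hc.ne'] at h2)
    rw [if_neg hY, if_neg hcY, mul_zero]

theorem chainBlock_zero {n : ℕ} {lam : ℝ} (i j : Fin n) (V T : ℕ → Mat W) :
    chainBlock n lam i j 0 (fun k => (V k, T k)) = resolventBlock n V T lam i j := by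
  unfold chainBlock
  congr 1
  ext1 k
  simp only [subHead, sub_zero]
  split_ifs with h
  · rw [h]
  · rfl

end Observables

end BandMatrix

/-! ### Transfer to the given random blocks -/

theorem mainTheorem4
    (S : Set ℕ) (hS : ∀ W ∈ S, 0 < W)
    (A : ∀ W : ℕ, NonUnitalStarSubalgebra ℝ (BandMatrix.Mat W))
    (P Q : ∀ W : ℕ, Measure (BandMatrix.Mat W))
    (ρ : ∀ W : ℕ, BandMatrix.Mat W → ℝ)
    (κ σ p₀ δ ε L a ζ q₀ τ b ν : ℝ)
    (hP : BandMatrix.DiagonalAssumption S A P ρ κ σ p₀ δ ε L a ζ)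
    (hQ : BandMatrix.OffDiagonalAssumption S A Q q₀ τ b)
    (hν : 0 < ν)
    (hD : BddAbove ((fun W : ℕ => (BandMatrix.hermDim (A W) : ℝ) * (W : ℝ) ^ (-ν)) '' S))
    (hν' : ζ + max a (1 + σ + 2 * b) ≤ ν)
    (r s Λ : ℝ) (hr : 0 < r) (hrs : r < s) (hs : s < 1) (hΛ : 0 < Λ) :
    ∃ C : ℝ, 0 < C ∧
      ∀ W ∈ S,
      ∀ (Ω : Type*) [MeasurableSpace Ω] (μ : Measure Ω) [IsProbabilityMeasure μ]
        (V T : ℕ → Ω → BandMatrix.Mat W),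
        (∀ k, HasLaw (V k) (P W) μ) →
        (∀ k, HasLaw (T k) (Q W) μ) →
        iIndepFun (fun k : ℕ ⊕ ℕ => Sum.elim V T k) μ →
      ∀ (n : ℕ) (i j : Fin n), 3 ≤ |(i : ℝ) - (j : ℝ)| →
      ∀ lam ∈ Set.Icc (-Λ) Λ,
      ∀ Φ : BandMatrix.Mat W → ℝ,
        Measurable (fun Y : BandMatrix.genAlg (A W) => Φ (Y : BandMatrix.Mat W)) →
        (∀ Y ∈ BandMatrix.genAlg (A W), 0 ≤ Φ Y) →
        (∀ Y ∈ BandMatrix.genAlg (A W), ∀ α : ℝ, 0 ≤ α → Φ (α • Y) = α * Φ Y) →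
        ∫⁻ ω, ENNReal.ofReal
            (Φ (BandMatrix.resolventBlock n (fun k => V k ω) (fun k => T k ω) lam i j)) ^ r ∂μ
          ≤ ENNReal.ofReal (Real.exp (-C * (W : ℝ) ^ (-2 * ν) * |(i : ℝ) - (j : ℝ)|)) *
            (∫⁻ ω, ENNReal.ofReal
              (Φ (BandMatrix.resolventBlock n (fun k => V k ω) (fun k => T k ω) lam i j)) ^ s ∂μ)
              ^ (r / s) := by
  obtain ⟨C, hC, hdecay⟩ := hP.exists_decay hQ hS hν hν' hr hrs hs hΛ
  refine ⟨C, hC, ?_⟩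
  intro W hW Ω _ μ _ V T hV hT hind n i j hij lam hlam Φ hΦ _ hhom
  have := hP.isProbabilityMeasure W hW
  have := hQ.isProbabilityMeasure W hW
  obtain ⟨E, hE⟩ := hP.exists_regularSite hQ hW lam
  have hlaw := BandMatrix.hasLaw_pairs hV hT hind
  have hVmem : ∀ᵐ ω ∂μ, ∀ k, V k ω ∈ BandMatrix.herm (A W) :=
    ae_all_iff.2 fun k => ae_of_ae_map (hV k).aemeasurable (by rw [(hV k).map_eq]; exact hE.ae_herm)
  have hTmem : ∀ᵐ ω ∂μ, ∀ k, T k ω ∈ BandMatrix.conjSet (A W) :=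
    ae_all_iff.2 fun k => ae_of_ae_map (hT k).aemeasurable
      (by rw [(hT k).map_eq]; exact hE.ae_conjSet)
  -- Moments depend only on the joint law of the sites. Indices and observable are left free so that
  -- the same transfer serves the block and its adjoint.
  have key : ∀ (i' j' : Fin n) (Ψ : BandMatrix.Mat W → ℝ≥0∞), Measurable Ψ →
      (∀ᵐ ω ∂μ, ENNReal.ofReal
        (Φ (BandMatrix.resolventBlock n (fun k => V k ω) (fun k => T k ω) lam i j)) =
        Ψ (BandMatrix.chainBlock n lam i' j' 0 fun k => (V k ω, T k ω))) → ∀ q : ℝ,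
      ∫⁻ ω, ENNReal.ofReal
        (Φ (BandMatrix.resolventBlock n (fun k => V k ω) (fun k => T k ω) lam i j)) ^ q ∂μ =
      ∫⁻ x, Ψ (BandMatrix.chainBlock n lam i' j' 0 x) ^ q
        ∂(Measure.infinitePi fun _ : ℕ => (P W).prod (Q W)) := by
    intro i' j' Ψ hΨ hae q
    have hm : Measurable fun x => Ψ (BandMatrix.chainBlock n lam i' j' 0 x) ^ q :=
      (hΨ.comp (Measurable.chainBlock _ _ measurable_const measurable_id)).pow_const q
    rw [← hlaw.map_eq, lintegral_map' hm.aemeasurable hlaw.aemeasurable]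
    refine lintegral_congr_ae ?_
    filter_upwards [hae] with ω hω
    rw [hω]
  have hmeas := BandMatrix.measurable_extendZero hΦ
  rcases le_total (i : ℕ) j with hle | hle
  · have habs : |(i : ℝ) - j| = (j : ℝ) - i := by
      rw [abs_sub_comm, abs_of_nonneg (sub_nonneg.2 (by exact_mod_cast hle))]
    rw [habs] at hij ⊢
    have hij' : (i : ℕ) + 3 ≤ j := by
      have : ((i : ℕ) : ℝ) + 3 ≤ (j : ℕ) := by linarith
      exact_mod_cast this
    have hae : ∀ᵐ ω ∂μ, ENNReal.ofReal
        (Φ (BandMatrix.resolventBlock n (fun k => V k ω) (fun k => T k ω) lam i j)) =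
        BandMatrix.extendZero (A W) Φ
          (BandMatrix.chainBlock n lam i j 0 fun k => (V k ω, T k ω)) := by
      filter_upwards [hVmem, hTmem] with ω h1 h2
      rw [BandMatrix.chainBlock_zero, BandMatrix.extendZero,
        if_pos (BandMatrix.resolventBlock_mem_genAlg hE.lam_mem h1 h2 i j)]
    rw [key i j _ hmeas hae, key i j _ hmeas hae]
    exact hdecay W hW n i j hij' lam hlam _ hmeas fun c hc Y =>
      BandMatrix.extendZero_smul hhom hc Y
  · have habs : |(i : ℝ) - j| = (i : ℝ) - j :=
      abs_of_nonneg (sub_nonneg.2 (by exact_mod_cast hle))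
    rw [habs] at hij ⊢
    have hij' : (j : ℕ) + 3 ≤ i := by
      have : ((j : ℕ) : ℝ) + 3 ≤ (i : ℕ) := by linarith
      exact_mod_cast this
    -- Below the diagonal, the block is the adjoint of one above it, and Y ↦ Φ(Y†) is again
    -- homogeneous.
    have hmeas' : Measurable fun Y : BandMatrix.Mat W => BandMatrix.extendZero (A W) Φ Yᴴ :=
      hmeas.comp measurable_id.matrix_conjTranspose
    have hae : ∀ᵐ ω ∂μ, ENNReal.ofReal
        (Φ (BandMatrix.resolventBlock n (fun k => V k ω) (fun k => T k ω) lam i j)) =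
        (fun Y => BandMatrix.extendZero (A W) Φ Yᴴ)
          (BandMatrix.chainBlock n lam j i 0 fun k => (V k ω, T k ω)) := by
      filter_upwards [hVmem, hTmem] with ω h1 h2
      simp only [BandMatrix.chainBlock_zero]
      rw [BandMatrix.resolventBlock_conjTranspose lam (fun k => (h1 k).2), BandMatrix.extendZero,
        if_pos (BandMatrix.resolventBlock_mem_genAlg hE.lam_mem h1 h2 i j)]
    rw [key j i _ hmeas' hae, key j i _ hmeas' hae]
    refine hdecay W hW n j i hij' lam hlam _ hmeas' fun c hc Y => ?_
    rw [Matrix.conjTranspose_smul, star_trivial]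
    exact BandMatrix.extendZero_smul hhom hc _
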